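/- Let $\Omega\subset\mathbb{R}^3$ be an open set (for example a bounded or unbounded Lipschitz domain), let $\gamma_e,\gamma_m>0$ and $\theta_e,\theta_m\in L^\infty(\Omega,\mathbb{R})$, and put $M=\max\{\gamma_e,\gamma_m\}$. Let $\operatorname{curl}$ be the maximal (weak) curl in $L^2(\Omega)^3=L^2(\Omega,\mathbb{C}^3)$, with domain $H(\operatorname{curl},\Omega)$, and $\operatorname{curl}_0$ its restriction to $H_0(\operatorname{curl},\Omega)$, the closure of $C_c^\infty(\Omega)^3$ in $H(\operatorname{curl},\Omega)$. For $*\in\{e,m\}$ let $\Theta_*(\omega)=\omega^2+i\gamma_*\omega-\theta_*^2$, acting by multiplication in $L^2(\Omega)^3$. For an operator $T$ in a Hilbert space let $W(T)=\{(Tu,u):u\in\operatorname{dom}T,\ \|u\|=1\}$ and let $\sigma(T)$ be the set of all $z\in\mathbb{C}$ such that $T-z$ is not boundedly invertible; for an operator pencil $\mathcal{T}$ with parameter domain $D\subset\mathbb{C}$ let $\sigma(\mathcal T)=\{\omega\in D:0\in\sigma(\mathcal T(\omega))\}$ and $W(\mathcal T)=\{\omega\in D:0\in\overline{W(\mathcal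 T(\omega))}\}$. The pencil $\Theta_m$ has $D=\mathbb{C}$. For $\omega\in\mathbb{C}\setminus\{-i\gamma_e,-i\gamma_m\}$ let $$\mathcal L(\omega)=\begin{pmatrix}-\omega+\frac{\theta_e^2}{\omega+i\gamma_e}& i\operatorname{curl}\\ -i\operatorname{curl}_0&-\omega+\frac{\theta_m^2}{\omega+i\gamma_m}\end{pmatrix},\qquad \operatorname{dom}\mathcal L(\omega)=H_0(\operatorname{curl},\Omega)\oplus H(\operatorname{curl},\Omega),$$ and for $\omega\in\mathbb{C}\setminus(\{-i\gamma_e,-i\gamma_m\}\cup\overline{W(\Theta_m)})$ let $$\mathcal S_1(\omega)=\operatorname{curl}\Theta_m(\omega)^{-1}\operatorname{curl}_0-\frac{\Theta_e(\omega)}{(\omega+i\gamma_e)(\omega+i\gamma_m)},$$ with $\operatorname{dom}\mathcal S_1(\omega)=\{u\in H_0(\operatorname{curl},\Omega):\Theta_m(\omega)^{-1}\operatorname{curl}_0u\in H(\operatorname{curl},\Omega)\}$. Let $\Sigma=\{\omega\in\mathbb{C}:\operatorname{Re}\omega\,\operatorname{Im}(\omega+i\gamma_m/2)\neq0\}$ and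 let $\Gamma=\Gamma_0\cup\Gamma_1$, where $$\Gamma_0=\{\omega\in\mathbb{C}:\operatorname{Re}\omega=0,\ \operatorname{Im}\omega\in(-M,0)\setminus\{-\gamma_e,-\gamma_m\}\}$$ (if $\gamma_m\le\gamma_e$, the condition on $\operatorname{Im}\omega$ is $\operatorname{Im}\omega\in(-\gamma_e,0)\setminus\{-\gamma_m\}$), and $\Gamma_1$ is the set of all $\omega\in\mathbb{C}$ such that $\operatorname{Re}\omega\neq0$, $\operatorname{Im}\omega\ge-(\gamma_e+\gamma_m)/2$ and $$0\le-\operatorname{Im}\omega\le\min\left(M,\frac{\gamma_e\|\theta_e\|_\infty^2+\gamma_m\|\theta_m\|_\infty^2}{(\operatorname{Re}\omega)^2}\right).$$ Then: (i) $\sigma(\mathcal L)\cap\Sigma\subset W(\mathcal S_1)\cap\Sigma$; (ii) $\sigma(\mathcal L)\setminus\overline{W(\Theta_m)}\subset(\Gamma\cup\{0\})\setminus\overline{W(\Theta_m)}$; (iii) if moreover $|\theta_e|\ge c$ almost everywhere in $\Omega$ for some constant $c>0$, then $\sigma(\mathcal L)\setminus\overline{W(\Theta_m)}\subset\Gamma\setminus\overline{W(\Theta_m)}$.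 -/

import Mathlib

open MeasureTheory

noncomputable section

namespace DrudeLorentz

/-! ### Unbounded operators and operator pencils on a complex Hilbert space -/

section Abstract

variable {H : Type*} [NormedAddCommGroup H] [InnerProductSpace ℂ H]

/-- `z` is in the resolvent set of the partially defined operator `T`: the map
`T - z : dom T → H` has an everywhere defined bounded two-sided inverse. -/
def IsRegularPoint (T : H →ₗ.[ℂ] H) (z : ℂ) : Prop :=
  ∃ R : H →L[ℂ] H,
    (∀ f : H, ∃ h : R f ∈ T.domain, T ⟨R f, h⟩ - z • R f = f) ∧
    (∀ u : T.domain, R (T u - z • (u : H)) = u)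

/-- The spectrum `σ(T)`: all `z` such that `T - z` is not boundedly invertible. -/
def opSpectrum (T : H →ₗ.[ℂ] H) : Set ℂ := {z | ¬ IsRegularPoint T z}

/-- The numerical range `W(T) = {(T u, u) : u ∈ dom T, ‖u‖ = 1}`. The inner product `(f, g)`,
linear in `f`, is `inner ℂ g f` in Mathlib. -/
def numRange (T : H →ₗ.[ℂ] H) : Set ℂ :=
  {z | ∃ u : T.domain, ‖(u : H)‖ = 1 ∧ inner ℂ (u : H) (T u) = z}

/-- The composition `g ∘ f` of partially defined operators, on its natural domain
`{x ∈ dom f : f x ∈ dom g}`. -/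
def pcomp (g f : H →ₗ.[ℂ] H) : H →ₗ.[ℂ] H where
  domain :=
    { carrier := {x | ∃ h : x ∈ f.domain, f ⟨x, h⟩ ∈ g.domain}
      add_mem' := by
        rintro x y ⟨hx, hx'⟩ ⟨hy, hy'⟩
        refine ⟨f.domain.add_mem hx hy, ?_⟩
        have := f.map_add ⟨x, hx⟩ ⟨y, hy⟩
        simp only [AddMemClass.mk_add_mk] at this
        rw [this]
        exact g.domain.add_mem hx' hy'
      zero_mem' := by
        refine ⟨f.domain.zero_mem, ?_⟩
        have h0 : f ⟨0, f.domain.zero_mem⟩ = 0 := f.map_zero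
        rw [h0]
        exact g.domain.zero_mem
      smul_mem' := by
        rintro c x ⟨hx, hx'⟩
        refine ⟨f.domain.smul_mem c hx, ?_⟩
        have := f.map_smul c ⟨x, hx⟩
        simp only [SetLike.mk_smul_mk] at this
        rw [this]
        exact g.domain.smul_mem c hx' }
  toFun :=
    { toFun := fun x => g ⟨f ⟨x.1, x.2.choose⟩, x.2.choose_spec⟩
      map_add' := by
        intro x y
        rw [← g.map_add]
        congr 1
        ext1
        exact f.map_add ⟨x.1, x.2.choose⟩ ⟨y.1, y.2.choose⟩
      map_smul' := by
        intro c x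
        rw [RingHom.id_apply, ← g.map_smul]
        congr 1
        ext1
        exact f.map_smul c ⟨x.1, x.2.choose⟩ }

/-- The operator matrix `(A B; C D)` in `H ⊕ H` (Hilbert space direct sum), on its natural domain
`(dom A ∩ dom C) ⊕ (dom B ∩ dom D)`. -/
def blockOp (A B C D : H →ₗ.[ℂ] H) : WithLp 2 (H × H) →ₗ.[ℂ] WithLp 2 (H × H) where
  domain :=
    { carrier := {p | p.fst ∈ A.domain ⊓ C.domain ∧ p.snd ∈ B.domain ⊓ D.domain}
      add_mem' := fun hp hq =>
        ⟨Submodule.add_mem _ hp.1 hq.1, Submodule.add_mem _ hp.2 hq.2⟩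
      zero_mem' := ⟨Submodule.zero_mem _, Submodule.zero_mem _⟩
      smul_mem' := fun c _ hp =>
        ⟨Submodule.smul_mem _ c hp.1, Submodule.smul_mem _ c hp.2⟩ }
  toFun :=
    { toFun := fun p => WithLp.toLp 2
        (A ⟨p.1.fst, p.2.1.1⟩ + B ⟨p.1.snd, p.2.2.1⟩, C ⟨p.1.fst, p.2.1.2⟩ + D ⟨p.1.snd, p.2.2.2⟩)
      map_add' := by
        intro p q
        have hA := A.map_add ⟨p.1.fst, p.2.1.1⟩ ⟨q.1.fst, q.2.1.1⟩
        have hB := B.map_add ⟨p.1.snd, p.2.2.1⟩ ⟨q.1.snd, q.2.2.1⟩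
        have hC := C.map_add ⟨p.1.fst, p.2.1.2⟩ ⟨q.1.fst, q.2.1.2⟩
        have hD := D.map_add ⟨p.1.snd, p.2.2.2⟩ ⟨q.1.snd, q.2.2.2⟩
        simp only [AddMemClass.mk_add_mk] at hA hB hC hD
        rw [← WithLp.toLp_add, Prod.mk_add_mk]
        simp only [Submodule.coe_add, WithLp.add_fst, WithLp.add_snd, hA, hB, hC, hD]
        congr 2 <;> abel
      map_smul' := by
        intro c p
        have hA := A.map_smul c ⟨p.1.fst, p.2.1.1⟩
        have hB := B.map_smul c ⟨p.1.snd, p.2.2.1⟩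
        have hC := C.map_smul c ⟨p.1.fst, p.2.1.2⟩
        have hD := D.map_smul c ⟨p.1.snd, p.2.2.2⟩
        simp only [SetLike.mk_smul_mk] at hA hB hC hD
        rw [RingHom.id_apply, ← WithLp.toLp_smul, Prod.smul_mk]
        simp only [Submodule.coe_smul, WithLp.smul_fst, WithLp.smul_snd, hA, hB, hC, hD, smul_add] }

end Abstract

/-- An operator pencil: a set of spectral parameters `dom` and, for `ω ∈ dom`, a partially defined
operator `op ω`. (The values of `op` outside `dom` are never used.) -/
structure Pencil (H : Type*) [NormedAddCommGroup H] [InnerProductSpace ℂ H] where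
  dom : Set ℂ
  op : ℂ → H →ₗ.[ℂ] H

section AbstractPencil

variable {H : Type*} [NormedAddCommGroup H] [InnerProductSpace ℂ H]

/-- `σ(P) = {ω : 0 ∈ σ(P(ω))}`. -/
def Pencil.spectrum (P : Pencil H) : Set ℂ := {ω | ω ∈ P.dom ∧ 0 ∈ opSpectrum (P.op ω)}

/-- `W(P) = {ω : 0 ∈ closure W(P(ω))}`. -/
def Pencil.numRange (P : Pencil H) : Set ℂ :=
  {ω | ω ∈ P.dom ∧ 0 ∈ closure (DrudeLorentz.numRange (P.op ω))}

end AbstractPencil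

/-! ### The curl operators in `L²(Ω)³` -/

/-- `ℝ³`. -/
abbrev R3 := EuclideanSpace ℝ (Fin 3)

/-- `ℂ³`. -/
abbrev C3 := EuclideanSpace ℂ (Fin 3)

/-- The Hilbert space `L²(Ω)³ = L²(Ω, ℂ³)`. -/
abbrev L2 (Ω : Set R3) := Lp C3 2 (volume.restrict Ω)

/-- The partial derivative `∂ⱼ φₖ`. -/
def pd (φ : R3 → C3) (j k : Fin 3) (x : R3) : ℂ :=
  fderiv ℝ φ x (EuclideanSpace.single j 1) k

/-- The classical curl of a vector field. -/
def curlVec (φ : R3 → C3) (x : R3) : C3 :=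
  !₂[pd φ 1 2 x - pd φ 2 1 x, pd φ 2 0 x - pd φ 0 2 x, pd φ 0 1 x - pd φ 1 0 x]

/-- The test fields `C_c^∞(Ω)³`. -/
structure IsTestField (Ω : Set R3) (φ : R3 → C3) : Prop where
  smooth : ContDiff ℝ ((⊤ : ℕ∞) : WithTop ℕ∞) φ
  compact : HasCompactSupport φ
  support : tsupport φ ⊆ Ω


theorem IsTestField.differentiable {Ω : Set R3} {φ : R3 → C3} (h : IsTestField Ω φ) :
    Differentiable ℝ φ :=
  h.smooth.differentiable (by simp)

theorem IsTestField.add {Ω : Set R3} {φ ψ : R3 → C3} (hφ : IsTestField Ω φ)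
    (hψ : IsTestField Ω ψ) : IsTestField Ω (φ + ψ) :=
  ⟨hφ.smooth.add hψ.smooth, hφ.compact.add hψ.compact,
    (tsupport_add φ ψ).trans (Set.union_subset hφ.support hψ.support)⟩

theorem IsTestField.smul {Ω : Set R3} {φ : R3 → C3} (hφ : IsTestField Ω φ) (c : ℂ) :
    IsTestField Ω (c • φ) := by
  have hsub : tsupport (c • φ) ⊆ tsupport φ := by
    refine closure_mono fun x hx => ?_
    simp only [Function.mem_support, Pi.smul_apply] at hx ⊢
    exact fun h0 => hx (by rw [h0, smul_zero])
  exact ⟨hφ.smooth.const_smul c,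
    hφ.compact.mono' ((subset_tsupport _).trans hsub), hsub.trans hφ.support⟩

theorem isTestField_zero (Ω : Set R3) : IsTestField Ω 0 :=
  ⟨contDiff_const, HasCompactSupport.zero, by simp [tsupport]⟩

theorem curlVec_add {φ ψ : R3 → C3} (hφ : Differentiable ℝ φ) (hψ : Differentiable ℝ ψ) :
    curlVec (φ + ψ) = curlVec φ + curlVec ψ := by
  funext x
  ext i
  fin_cases i <;>
    simp [curlVec, pd, fderiv_add (hφ x) (hψ x)] <;> ring

theorem curlVec_smul {φ : R3 → C3} (hφ : Differentiable ℝ φ) (c : ℂ) :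
    curlVec (c • φ) = c • curlVec φ := by
  funext x
  ext i
  fin_cases i <;>
    simp [curlVec, pd, fderiv_const_smul (hφ x) c] <;> ring

theorem curlVec_zero : curlVec 0 = 0 := by
  funext x
  ext i
  fin_cases i <;> simp [curlVec, pd]

theorem IsTestField.continuous_pd {Ω : Set R3} {φ : R3 → C3} (h : IsTestField Ω φ)
    (j k : Fin 3) : Continuous (pd φ j k) := by
  have h1 : Continuous (fderiv ℝ φ) := h.smooth.continuous_fderiv (by simp)
  unfold pd
  fun_prop

theorem IsTestField.compact_pd {Ω : Set R3} {φ : R3 → C3} (h : IsTestField Ω φ)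
    (j k : Fin 3) : HasCompactSupport (pd φ j k) := by
  refine (h.compact.fderiv (𝕜 := ℝ)).mono fun x hx => ?_
  simp only [Function.mem_support, pd] at hx ⊢
  exact fun h0 => hx (by rw [h0]; simp)

theorem IsTestField.continuous_curlVec {Ω : Set R3} {φ : R3 → C3} (h : IsTestField Ω φ) :
    Continuous (curlVec φ) := by
  have := h.continuous_pd
  unfold curlVec
  refine (PiLp.continuous_toLp 2 _).comp (continuous_pi fun i => ?_)
  fin_cases i <;> simp <;> exact (this _ _).sub (this _ _)

theorem IsTestField.compact_curlVec {Ω : Set R3} {φ : R3 → C3} (h : IsTestField Ω φ) :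
    HasCompactSupport (curlVec φ) := by
  refine (h.compact.fderiv (𝕜 := ℝ)).mono fun x hx => ?_
  simp only [Function.mem_support] at hx ⊢
  refine fun h0 => hx ?_
  ext i
  fin_cases i <;> simp [curlVec, pd, h0]

theorem IsTestField.memLp {Ω : Set R3} {φ : R3 → C3} (h : IsTestField Ω φ) :
    MemLp φ 2 (volume.restrict Ω) :=
  h.smooth.continuous.memLp_of_hasCompactSupport h.compact

theorem IsTestField.memLp_curlVec {Ω : Set R3} {φ : R3 → C3} (h : IsTestField Ω φ) :
    MemLp (curlVec φ) 2 (volume.restrict Ω) :=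
  h.continuous_curlVec.memLp_of_hasCompactSupport h.compact_curlVec

theorem integrable_inner_memLp {Ω : Set R3} {f : R3 → C3}
    (hf : MemLp f 2 (volume.restrict Ω)) (u : L2 Ω) :
    Integrable (fun x => inner ℂ (f x) (u x)) (volume.restrict Ω) := by
  refine (L2.integrable_inner (𝕜 := ℂ) (hf.toLp f) u).congr ?_
  filter_upwards [hf.coeFn_toLp] with x hx
  rw [hx]

/-- The graph of the classical curl on `C_c^∞(Ω)³`, inside `L²(Ω)³ × L²(Ω)³`. -/
def testGraph (Ω : Set R3) : Submodule ℂ (L2 Ω × L2 Ω) where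
  carrier := {p | ∃ φ, IsTestField Ω φ ∧
    p.1 =ᵐ[volume.restrict Ω] φ ∧ p.2 =ᵐ[volume.restrict Ω] curlVec φ}
  add_mem' := by
    rintro p q ⟨φ, hφ, h1, h2⟩ ⟨ψ, hψ, h3, h4⟩
    refine ⟨φ + ψ, hφ.add hψ, (Lp.coeFn_add _ _).trans (h1.add h3), ?_⟩
    rw [curlVec_add hφ.differentiable hψ.differentiable]
    exact (Lp.coeFn_add _ _).trans (h2.add h4)
  zero_mem' :=
    ⟨0, isTestField_zero Ω, Lp.coeFn_zero _ _ _, by rw [curlVec_zero]; exact Lp.coeFn_zero _ _ _⟩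
  smul_mem' := by
    rintro c p ⟨φ, hφ, h1, h2⟩
    refine ⟨c • φ, hφ.smul c, (Lp.coeFn_smul _ _).trans (h1.const_smul c), ?_⟩
    rw [curlVec_smul hφ.differentiable]
    exact (Lp.coeFn_smul _ _).trans (h2.const_smul c)

/-- The graph of the weak curl: all `(u, w)` in `L²(Ω)³ × L²(Ω)³` such that
`∫_Ω u · curl φ = ∫_Ω w · φ` for all test fields `φ` (with the test field conjugated). -/
def weakCurlGraph (Ω : Set R3) : Submodule ℂ (L2 Ω × L2 Ω) where
  carrier := {p | ∀ φ, IsTestField Ω φ →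
    ∫ x in Ω, inner ℂ (curlVec φ x) (p.1 x) = ∫ x in Ω, inner ℂ (φ x) (p.2 x)}
  add_mem' := by
    intro p q hp hq φ hφ
    have key : ∀ (f : R3 → C3) (_ : MemLp f 2 (volume.restrict Ω)) (u v : L2 Ω),
        ∫ x in Ω, inner ℂ (f x) ((u + v : L2 Ω) x) =
          (∫ x in Ω, inner ℂ (f x) (u x)) + ∫ x in Ω, inner ℂ (f x) (v x) := by
      intro f hf u v
      rw [← integral_add (integrable_inner_memLp hf u) (integrable_inner_memLp hf v)]
      refine integral_congr_ae ?_
      filter_upwards [Lp.coeFn_add u v] with x hx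
      rw [hx, Pi.add_apply, inner_add_right]
    rw [Prod.fst_add, Prod.snd_add, key _ hφ.memLp_curlVec, key _ hφ.memLp, hp φ hφ, hq φ hφ]
  zero_mem' := by
    intro φ _
    have key : ∀ f : R3 → C3, ∫ x in Ω, inner ℂ (f x) ((0 : L2 Ω) x) = (0 : ℂ) := by
      intro f
      rw [integral_eq_zero_of_ae]
      filter_upwards [Lp.coeFn_zero C3 2 (volume.restrict Ω)] with x hx
      rw [hx]; simp
    rw [Prod.fst_zero, Prod.snd_zero, key, key]
  smul_mem' := by
    intro c p hp φ hφ
    have key : ∀ (f : R3 → C3) (u : L2 Ω),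
        ∫ x in Ω, inner ℂ (f x) ((c • u : L2 Ω) x) = c * ∫ x in Ω, inner ℂ (f x) (u x) := by
      intro f u
      rw [← integral_const_mul]
      refine integral_congr_ae ?_
      filter_upwards [Lp.coeFn_smul c u] with x hx
      rw [hx, Pi.smul_apply, inner_smul_right]
    rw [Prod.smul_fst, Prod.smul_snd, key, key, hp φ hφ]

/-- The maximal realisation `curl`, with domain `H(curl, Ω)`: the operator whose graph is the
graph of the weak curl. -/
def curl (Ω : Set R3) : L2 Ω →ₗ.[ℂ] L2 Ω := (weakCurlGraph Ω).toLinearPMap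

/-- The minimal realisation `curl₀`, with domain `H₀(curl, Ω)`, the closure of `C_c^∞(Ω)³` in the
norm of `H(curl, Ω)`: the operator whose graph is the closure of the graph of the classical curl on
test fields. -/
def curl₀ (Ω : Set R3) : L2 Ω →ₗ.[ℂ] L2 Ω := (testGraph Ω).topologicalClosure.toLinearPMap

/-! The two graphs are indeed graphs of operators (on an open set), and `curl₀ ≤ curl`. -/

theorem weakCurlGraph_functional {Ω : Set R3} (hΩ : IsOpen Ω) {p : L2 Ω × L2 Ω}
    (hp : p ∈ weakCurlGraph Ω) (h1 : p.1 = 0) : p.2 = 0 := by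
  have hzero : ∀ φ, IsTestField Ω φ → ∫ x in Ω, inner ℂ (φ x) (p.2 x) = (0 : ℂ) := by
    intro φ hφ
    rw [← hp φ hφ, h1]
    rw [integral_eq_zero_of_ae]
    filter_upwards [Lp.coeFn_zero C3 2 (volume.restrict Ω)] with x hx
    rw [hx]; simp
  have hcomp : ∀ k : Fin 3, ∀ᵐ x, x ∈ Ω → (p.2 : R3 → C3) x k = 0 := by
    intro k
    refine hΩ.ae_eq_zero_of_integral_contDiff_smul_eq_zero (f := fun x => (p.2 : R3 → C3) x k) ?_ ?_
    · refine locallyIntegrableOn_of_locallyIntegrable_restrict ?_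
      have hm : MemLp (fun x => (p.2 : R3 → C3) x k) 2 (volume.restrict Ω) :=
        ((EuclideanSpace.proj k : C3 →L[ℂ] ℂ)).comp_memLp' (Lp.memLp p.2)
      exact hm.locallyIntegrable (by norm_num)
    · intro g hg hgc hgs
      have hsub : (Function.support fun x => g x • (EuclideanSpace.single k (1 : ℂ) : C3)) ⊆
          Function.support g := by
        intro x hx h0
        exact hx (by simp [h0])
      have hφ : IsTestField Ω (fun x => g x • (EuclideanSpace.single k (1 : ℂ) : C3)) :=
        ⟨hg.smul contDiff_const, hgc.mono hsub, (closure_mono hsub).trans hgs⟩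
      have h := hzero _ hφ
      rw [← h, ← setIntegral_eq_integral_of_forall_compl_eq_zero (s := Ω)]
      · refine integral_congr_ae (Filter.Eventually.of_forall fun x => ?_)
        simp [inner_smul_left_eq_star_smul, EuclideanSpace.inner_single_left]
      · intro x hx
        have : g x = 0 := by
          by_contra h0
          exact hx (hgs (subset_tsupport g h0))
        simp [this]
  refine (Lp.eq_zero_iff_ae_eq_zero).2 ?_
  rw [Filter.EventuallyEq, ae_restrict_iff' hΩ.measurableSet]
  filter_upwards [hcomp 0, hcomp 1, hcomp 2] with x h0 h1 h2 hx
  ext i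
  fin_cases i
  · exact h0 hx
  · exact h1 hx
  · exact h2 hx

theorem integral_pd {Ω : Set R3} {φ ψ : R3 → C3} (hφ : IsTestField Ω φ) (hψ : IsTestField Ω ψ)
    (j k i : Fin 3) :
    ∫ x, ψ x i * (starRingEnd ℂ) (pd φ j k x) = - ∫ x, pd ψ j i x * (starRingEnd ℂ) (φ x k) := by
  have hpd : ∀ {χ : R3 → C3} (_ : IsTestField Ω χ) (l : Fin 3) (x : R3),
      HasFDerivAt (fun y => χ y l)
        (((EuclideanSpace.proj l : C3 →L[ℂ] ℂ).restrictScalars ℝ).comp (fderiv ℝ χ x)) x :=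
    fun {χ} hχ l x =>
      ((EuclideanSpace.proj l : C3 →L[ℂ] ℂ).restrictScalars ℝ).hasFDerivAt.comp x
        (hχ.differentiable x).hasFDerivAt
  have hcj : ∀ x, HasFDerivAt (fun y => (starRingEnd ℂ) (φ y k))
      ((Complex.conjCLE : ℂ →L[ℝ] ℂ).comp
        (((EuclideanSpace.proj k : C3 →L[ℂ] ℂ).restrictScalars ℝ).comp (fderiv ℝ φ x))) x :=
    fun x => (Complex.conjCLE : ℂ →L[ℝ] ℂ).hasFDerivAt.comp x (hpd hφ k x)
  have e1 : ∀ x, fderiv ℝ (fun y => ψ y i) x (EuclideanSpace.single j 1) = pd ψ j i x := by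
    intro x; rw [(hpd hψ i x).fderiv]; rfl
  have e2 : ∀ x, fderiv ℝ (fun y => (starRingEnd ℂ) (φ y k)) x (EuclideanSpace.single j 1) =
      (starRingEnd ℂ) (pd φ j k x) := by
    intro x; rw [(hcj x).fderiv]; rfl
  have cψ : Continuous fun x => ψ x i := by
    have := hψ.smooth.continuous; fun_prop
  have cφ : Continuous fun x => (starRingEnd ℂ) (φ x k) := by
    have := hφ.smooth.continuous
    exact Complex.continuous_conj.comp (by fun_prop)
  have sψ : HasCompactSupport fun x => ψ x i :=
    hψ.compact.mono fun x hx h0 => hx (by simp [h0])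
  have cpφ : Continuous fun x => (starRingEnd ℂ) (pd φ j k x) :=
    Complex.continuous_conj.comp (hφ.continuous_pd j k)
  have h := integral_mul_fderiv_eq_neg_fderiv_mul_of_integrable (μ := (volume : Measure R3))
    (f := fun y => ψ y i) (g := fun y => (starRingEnd ℂ) (φ y k)) (v := EuclideanSpace.single j 1)
    (by
      simp only [e1]
      exact ((hψ.continuous_pd j i).mul cφ).integrable_of_hasCompactSupport
        ((hψ.compact_pd j i).mul_right))
    (by
      simp only [e2]
      exact (cψ.mul cpφ).integrable_of_hasCompactSupport sψ.mul_right)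
    ((cψ.mul cφ).integrable_of_hasCompactSupport sψ.mul_right)
    (fun x _ => (hpd hψ i x).differentiableAt) (fun x _ => (hcj x).differentiableAt)
  simpa only [e1, e2] using h

theorem integral_six {a b c d e f : R3 → ℂ} (ha : Integrable a) (hb : Integrable b)
    (hc : Integrable c) (hd : Integrable d) (he : Integrable e) (hf : Integrable f) :
    ((∫ x, a x) - ∫ x, b x) + ((∫ x, c x) - ∫ x, d x) + ((∫ x, e x) - ∫ x, f x) =
      ∫ x, ((a x - b x) + (c x - d x) + (e x - f x)) := by
  have h1 : Integrable fun x => a x - b x := ha.sub hb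
  have h2 : Integrable fun x => c x - d x := hc.sub hd
  have h3 : Integrable fun x => e x - f x := he.sub hf
  have h12 : Integrable fun x => (a x - b x) + (c x - d x) := h1.add h2
  rw [integral_add h12 h3, integral_add h1 h2, integral_sub ha hb, integral_sub hc hd,
    integral_sub he hf]

theorem testGraph_le (Ω : Set R3) : testGraph Ω ≤ weakCurlGraph Ω := by
  rintro p ⟨ψ, hψ, h1, h2⟩ φ hφ
  have hφ0 : ∀ x, x ∉ Ω → φ x = 0 := fun x hx => by
    by_contra h0; exact hx (hφ.support (subset_tsupport φ h0))
  have hψ0 : ∀ x, x ∉ Ω → ψ x = 0 := fun x hx => by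
    by_contra h0; exact hx (hψ.support (subset_tsupport ψ h0))
  have l1 : ∫ x in Ω, inner ℂ (curlVec φ x) (p.1 x) = ∫ x, inner ℂ (curlVec φ x) (ψ x) := by
    refine Eq.trans (integral_congr_ae ?_) (setIntegral_eq_integral_of_forall_compl_eq_zero
      (s := Ω) (fun x hx => by rw [hψ0 x hx, inner_zero_right]))
    filter_upwards [h1] with x hx
    rw [hx]
  have l2 : ∫ x in Ω, inner ℂ (φ x) (p.2 x) = ∫ x, inner ℂ (φ x) (curlVec ψ x) := by
    refine Eq.trans (integral_congr_ae ?_) (setIntegral_eq_integral_of_forall_compl_eq_zero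
      (s := Ω) (fun x hx => by rw [hφ0 x hx, inner_zero_left]))
    filter_upwards [h2] with x hx
    rw [hx]
  have iψ : ∀ j k i, Integrable fun x => ψ x i * (starRingEnd ℂ) (pd φ j k x) := by
    intro j k i
    have cψ : Continuous fun x => ψ x i := by
      have := hψ.smooth.continuous; fun_prop
    have sψ : HasCompactSupport fun x => ψ x i :=
      hψ.compact.mono fun x hx h0 => hx (by simp [h0])
    exact (cψ.mul (Complex.continuous_conj.comp
      (hφ.continuous_pd j k))).integrable_of_hasCompactSupport sψ.mul_right
  have iφ : ∀ j k i, Integrable fun x => pd ψ j i x * (starRingEnd ℂ) (φ x k) := by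
    intro j k i
    have cφ : Continuous fun x => (starRingEnd ℂ) (φ x k) := by
      have := hφ.smooth.continuous
      exact Complex.continuous_conj.comp (by fun_prop)
    exact ((hψ.continuous_pd j i).mul cφ).integrable_of_hasCompactSupport
      ((hψ.compact_pd j i).mul_right)
  have s1 : ∫ x, inner ℂ (curlVec φ x) (ψ x) =
      ((∫ x, ψ x 0 * (starRingEnd ℂ) (pd φ 1 2 x)) - ∫ x, ψ x 0 * (starRingEnd ℂ) (pd φ 2 1 x)) +
      ((∫ x, ψ x 1 * (starRingEnd ℂ) (pd φ 2 0 x)) - ∫ x, ψ x 1 * (starRingEnd ℂ) (pd φ 0 2 x)) +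
      ((∫ x, ψ x 2 * (starRingEnd ℂ) (pd φ 0 1 x)) -
        ∫ x, ψ x 2 * (starRingEnd ℂ) (pd φ 1 0 x)) := by
    rw [integral_six (iψ _ _ _) (iψ _ _ _) (iψ _ _ _) (iψ _ _ _) (iψ _ _ _) (iψ _ _ _)]
    refine integral_congr_ae (Filter.Eventually.of_forall fun x => ?_)
    simp [PiLp.inner_apply, Fin.sum_univ_three, curlVec, mul_sub]
  have s2 : ∫ x, inner ℂ (φ x) (curlVec ψ x) =
      ((∫ x, pd ψ 1 2 x * (starRingEnd ℂ) (φ x 0)) - ∫ x, pd ψ 2 1 x * (starRingEnd ℂ) (φ x 0)) +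
      ((∫ x, pd ψ 2 0 x * (starRingEnd ℂ) (φ x 1)) - ∫ x, pd ψ 0 2 x * (starRingEnd ℂ) (φ x 1)) +
      ((∫ x, pd ψ 0 1 x * (starRingEnd ℂ) (φ x 2)) -
        ∫ x, pd ψ 1 0 x * (starRingEnd ℂ) (φ x 2)) := by
    rw [integral_six (iφ _ _ _) (iφ _ _ _) (iφ _ _ _) (iφ _ _ _) (iφ _ _ _) (iφ _ _ _)]
    refine integral_congr_ae (Filter.Eventually.of_forall fun x => ?_)
    simp [PiLp.inner_apply, Fin.sum_univ_three, curlVec, sub_mul]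
  rw [l1, l2, s1, s2]
  simp only [integral_pd hφ hψ]
  ring

theorem isClosed_weakCurlGraph (Ω : Set R3) : IsClosed (weakCurlGraph Ω : Set (L2 Ω × L2 Ω)) := by
  have key : ∀ f : R3 → C3, MemLp f 2 (volume.restrict Ω) →
      Continuous fun u : L2 Ω => ∫ x in Ω, inner ℂ (f x) (u x) := by
    intro f hf
    have : (fun u : L2 Ω => ∫ x in Ω, inner ℂ (f x) (u x)) =
        fun u => inner ℂ (hf.toLp f) u := by
      funext u
      rw [L2.inner_def]
      refine integral_congr_ae ?_
      filter_upwards [hf.coeFn_toLp] with x hx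
      rw [hx]
    rw [this]
    fun_prop
  have : (weakCurlGraph Ω : Set (L2 Ω × L2 Ω)) = ⋂ φ, ⋂ _ : IsTestField Ω φ,
      {p | ∫ x in Ω, inner ℂ (curlVec φ x) (p.1 x) = ∫ x in Ω, inner ℂ (φ x) (p.2 x)} := by
    ext p
    simp only [Set.mem_iInter]
    rfl
  rw [this]
  exact isClosed_iInter fun φ => isClosed_iInter fun hφ =>
    isClosed_eq ((key _ hφ.memLp_curlVec).comp continuous_fst)
      ((key _ hφ.memLp).comp continuous_snd)

theorem graph_curl {Ω : Set R3} (hΩ : IsOpen Ω) : (curl Ω).graph = weakCurlGraph Ω :=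
  Submodule.toLinearPMap_graph_eq _ fun _ hp h1 => weakCurlGraph_functional hΩ hp h1

theorem closure_testGraph_le (Ω : Set R3) :
    (testGraph Ω).topologicalClosure ≤ weakCurlGraph Ω :=
  Submodule.topologicalClosure_minimal _ (testGraph_le Ω) (isClosed_weakCurlGraph Ω)

theorem graph_curl₀ {Ω : Set R3} (hΩ : IsOpen Ω) :
    (curl₀ Ω).graph = (testGraph Ω).topologicalClosure :=
  Submodule.toLinearPMap_graph_eq _ fun _ hp h1 =>
    weakCurlGraph_functional hΩ (closure_testGraph_le Ω hp) h1

/-! ### Multiplication operators and the pencils of the Drude-Lorentz system -/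

theorem smul_add_ae {Ω : Set R3} (g : R3 → ℂ) (u v : L2 Ω) :
    (fun x => g x • (u + v : L2 Ω) x) =ᵐ[volume.restrict Ω]
      (fun x => g x • u x) + fun x => g x • v x := by
  filter_upwards [Lp.coeFn_add u v] with x hx
  rw [hx, Pi.add_apply, smul_add, Pi.add_apply]

theorem smul_smul_ae {Ω : Set R3} (g : R3 → ℂ) (c : ℂ) (u : L2 Ω) :
    (fun x => g x • (c • u : L2 Ω) x) =ᵐ[volume.restrict Ω] c • fun x => g x • u x := by
  filter_upwards [Lp.coeFn_smul c u] with x hx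
  rw [hx, Pi.smul_apply, Pi.smul_apply, smul_comm]

/-- The natural domain `{u : g u ∈ L²(Ω)³}` of the multiplication operator `u ↦ g u`. -/
def mulDomain (Ω : Set R3) (g : R3 → ℂ) : Submodule ℂ (L2 Ω) where
  carrier := {u | MemLp (fun x => g x • (u : R3 → C3) x) 2 (volume.restrict Ω)}
  add_mem' := by
    intro u v hu hv
    exact (memLp_congr_ae (smul_add_ae g u v)).2 (MemLp.add hu hv)
  zero_mem' := by
    refine (memLp_congr_ae (g := fun _ => (0 : C3)) ?_).2 MemLp.zero'
    filter_upwards [Lp.coeFn_zero C3 2 (volume.restrict Ω)] with x hx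
    rw [hx, Pi.zero_apply, smul_zero]
  smul_mem' := by
    intro c u hu
    have h : MemLp (c • fun x => g x • (u : R3 → C3) x) 2 (volume.restrict Ω) :=
      MemLp.const_smul hu c
    exact (memLp_congr_ae (smul_smul_ae g c u)).2 h

theorem memLp_of_mem_mulDomain {Ω : Set R3} {g : R3 → ℂ} {u : L2 Ω} (hu : u ∈ mulDomain Ω g) :
    MemLp (fun x => g x • (u : R3 → C3) x) 2 (volume.restrict Ω) := hu

/-- The multiplication operator `u ↦ g u` in `L²(Ω)³` on its natural domain, which is all of
`L²(Ω)³` if `g` is essentially bounded. -/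
def mulOp (Ω : Set R3) (g : R3 → ℂ) : L2 Ω →ₗ.[ℂ] L2 Ω where
  domain := mulDomain Ω g
  toFun :=
    { toFun := fun u => (memLp_of_mem_mulDomain u.2).toLp
      map_add' := by
        intro u v
        refine Lp.ext ?_
        filter_upwards [(memLp_of_mem_mulDomain (u + v).2).coeFn_toLp,
          (memLp_of_mem_mulDomain u.2).coeFn_toLp, (memLp_of_mem_mulDomain v.2).coeFn_toLp,
          Lp.coeFn_add (memLp_of_mem_mulDomain u.2).toLp (memLp_of_mem_mulDomain v.2).toLp,
          smul_add_ae g u.1 v.1] with x h1 h2 h3 h4 h5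
        rw [h1, h4, Pi.add_apply, h2, h3]
        exact h5
      map_smul' := by
        intro c u
        refine Lp.ext ?_
        filter_upwards [(memLp_of_mem_mulDomain (c • u).2).coeFn_toLp,
          (memLp_of_mem_mulDomain u.2).coeFn_toLp,
          Lp.coeFn_smul c (memLp_of_mem_mulDomain u.2).toLp,
          smul_smul_ae g c u.1] with x h1 h2 h3 h4
        rw [RingHom.id_apply, h1, h3, Pi.smul_apply, h2]
        exact h4 }

theorem mulOp_domain {Ω : Set R3} {g : R3 → ℂ} (hg : MemLp g ⊤ (volume.restrict Ω)) :
    (mulOp Ω g).domain = ⊤ :=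
  eq_top_iff.2 fun u _ => MemLp.smul (Lp.memLp u) hg

/-- `Θ(ω) = ω² + iγω - θ²` at a point `x`, for a damping constant `γ` and a coefficient `θ`. -/
def theta (γ : ℝ) (θ : R3 → ℝ) (ω : ℂ) (x : R3) : ℂ :=
  ω ^ 2 + Complex.I * γ * ω - (θ x : ℂ) ^ 2

/-- The pencil of multiplication operators `Θ(ω)` in `L²(Ω)³`. -/
def thetaPencil (Ω : Set R3) (γ : ℝ) (θ : R3 → ℝ) : Pencil (L2 Ω) where
  dom := Set.univ
  op ω := mulOp Ω (theta γ θ ω)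

/-- The Drude-Lorentz pencil
`𝓛(ω) = (-ω + θₑ²/(ω + iγₑ), i curl; -i curl₀, -ω + θₘ²/(ω + iγₘ))` in `L²(Ω)³ ⊕ L²(Ω)³`, with
domain `H₀(curl, Ω) ⊕ H(curl, Ω)`, for `ω ∈ ℂ \ {-iγₑ, -iγₘ}`. -/
def maxwellPencil (Ω : Set R3) (γe γm : ℝ) (θe θm : R3 → ℝ) : Pencil (WithLp 2 (L2 Ω × L2 Ω)) where
  dom := {-(Complex.I * γe), -(Complex.I * γm)}ᶜ
  op ω := blockOp
    (mulOp Ω fun x => -ω + (θe x : ℂ) ^ 2 / (ω + Complex.I * γe)) (Complex.I • curl Ω)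
    (-(Complex.I • curl₀ Ω)) (mulOp Ω fun x => -ω + (θm x : ℂ) ^ 2 / (ω + Complex.I * γm))

/-- The first Schur complement
`𝓢₁(ω) = curl Θₘ(ω)⁻¹ curl₀ - Θₑ(ω) / ((ω + iγₑ)(ω + iγₘ))` in `L²(Ω)³`, with domain
`{u ∈ H₀(curl, Ω) : Θₘ(ω)⁻¹ curl₀ u ∈ H(curl, Ω)}`, for
`ω ∈ ℂ \ ({-iγₑ, -iγₘ} ∪ closure W(Θₘ))`. -/
def schurPencil (Ω : Set R3) (γe γm : ℝ) (θe θm : R3 → ℝ) : Pencil (L2 Ω) where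
  dom := ({-(Complex.I * γe), -(Complex.I * γm)} ∪ closure (thetaPencil Ω γm θm).numRange)ᶜ
  op ω := pcomp (curl Ω) (pcomp (mulOp Ω fun x => (theta γm θm ω x)⁻¹) (curl₀ Ω)) -
    mulOp Ω fun x => theta γe θe ω x / ((ω + Complex.I * γe) * (ω + Complex.I * γm))

/-! ### The sets in the enclosures -/

/-- `Σ = {ω : Re ω · Im(ω + iγₘ/2) ≠ 0}`. -/
def sigmaSet (γm : ℝ) : Set ℂ := {ω | ω.re * (ω + Complex.I * γm / 2).im ≠ 0}

/-- `‖θ‖_∞` on `Ω`. -/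
def supNorm (Ω : Set R3) (θ : R3 → ℝ) : ℝ := (eLpNorm θ ⊤ (volume.restrict Ω)).toReal

/-- The numerical range bound
`0 ≤ -Im ω ≤ min(M, (γₑ‖θₑ‖_∞² + γₘ‖θₘ‖_∞²) / (Re ω)²)`, `M = max(γₑ, γₘ)`. -/
def NumRangeBound (Ω : Set R3) (γe γm : ℝ) (θe θm : R3 → ℝ) (ω : ℂ) : Prop :=
  0 ≤ -ω.im ∧
    -ω.im ≤ min (max γe γm) ((γe * supNorm Ω θe ^ 2 + γm * supNorm Ω θm ^ 2) / ω.re ^ 2)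

/-- The enclosing set `Γ`, with `M = max(γₑ, γₘ)`; if `γₘ ≤ γₑ`, its part on the imaginary axis is
`Im ω ∈ (-γₑ, 0) \ {-γₘ}`. -/
def gammaSet (Ω : Set R3) (γe γm : ℝ) (θe θm : R3 → ℝ) : Set ℂ :=
  {ω | ω.re = 0 ∧ ω.im ∈ Set.Ioo (-max γe γm) 0 \ {-γe, -γm}} ∪
    {ω | ω.re ≠ 0 ∧ -((γe + γm) / 2) ≤ ω.im ∧ NumRangeBound Ω γe γm θe θm ω}

end DrudeLorentz
end

/-!
Put `A = curl₀` and `B = curl`. On an open set these operators are adjoint to each other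
(`isAdjointPair_curl`): `curl` is by definition the adjoint of the classical curl on test fields,
and the closure of a graph is its second adjoint. Hence `𝓛(ω)` has the form `T = (a, iB; -iA, d)`
with bounded multiplication operators `a`, `d`; it is closed, and the orthogonal complement of its
range is contained in the kernel of `T' = (a*, iB; -iA, d*)`. So `T` is boundedly invertible as
soon as `T` and `T'` are bounded below (`isRegularPoint_maxwellOp`). Both bounds follow from
estimates of quadratic forms that are invariant under complex conjugation, so that each estimate
serves for `T` and `T'` at once.

*Enclosure by `Γ`.* If `T (u, v) = (f, g)`, then the off-diagonal part drops out of
`(f, u) - conj (g, v) = (a u, u) - conj (d v, v)`. If `T` is not boundedly invertible, the right-hand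
side therefore comes arbitrarily close to zero on the unit sphere. It is linear in the numbers
`‖u‖²`, `‖v‖²`, `‖θₑ u‖²`, `‖θₘ v‖²`, which range in a compact set, so it vanishes for some limit
values (`exists_quadratic_eq_of_mem_spectrum`). The real and the imaginary part of this scalar
equation give all the bounds that define `Γ` (`enclosure_of_quadratic_eq`), and at `ω = 0` they give
`‖θₑ u‖ = ‖θₘ v‖ = 0`, which is excluded if `θₑ²` and `θₘ²` are bounded away from zero.

*Schur complement.* Let `ω ∈ Σ`. Then `Im (Θₘ(ω) z, z)` is a nonzero multiple of `‖z‖²`, so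
`m = Θₘ(ω)⁻¹` is bounded and `|(m w, w)| ≥ c ‖w‖²`. Suppose that `0` is not in the closure of the
numerical range of `𝓢₁(ω)`. The domain of `𝓢₁(ω)` is a core of `A`, by the Lax-Milgram
lemma (`graph_subset_closure_core`), hence `|(m A u, A u) - (q u, u)| ≥ δ ‖u‖²` on all of `dom A`.
With the bound on `m`, the form controls the graph norm of `A`, and elimination of `v` from
`T (u, v) = (f, g)` shows that `T` is bounded below (`bddBelow_of_form`).
-/

namespace DrudeLorentz

/-! ### Adjoint pairs of closed operators -/

section AdjointPairs

variable {H : Type*} [NormedAddCommGroup H] [InnerProductSpace ℂ H]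

/-- The operators `A` and `B` are adjoint to each other, `B = A*` and `A = B*`, expressed through
their graphs. -/
structure IsAdjointPair (A B : H →ₗ.[ℂ] H) : Prop where
  mem_right_iff : ∀ v z, (v, z) ∈ B.graph ↔
    ∀ u w, (u, w) ∈ A.graph → inner ℂ w v = inner ℂ u z
  mem_left_iff : ∀ u w, (u, w) ∈ A.graph ↔
    ∀ v z, (v, z) ∈ B.graph → inner ℂ z u = inner ℂ v w

theorem IsAdjointPair.symm {A B : H →ₗ.[ℂ] H} (h : IsAdjointPair A B) : IsAdjointPair B A :=
  ⟨h.mem_left_iff, h.mem_right_iff⟩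

theorem IsAdjointPair.inner_eq {A B : H →ₗ.[ℂ] H} (h : IsAdjointPair A B) {u w v z : H}
    (hu : (u, w) ∈ A.graph) (hv : (v, z) ∈ B.graph) : inner ℂ w v = inner ℂ u z :=
  (h.mem_right_iff v z).1 hv u w hu

theorem IsAdjointPair.isClosed_graph_left {A B : H →ₗ.[ℂ] H} (h : IsAdjointPair A B) :
    IsClosed (A.graph : Set (H × H)) := by
  have : (A.graph : Set (H × H)) = ⋂ v, ⋂ z, ⋂ _ : (v, z) ∈ B.graph,
      {p : H × H | inner ℂ z p.1 = inner ℂ v p.2} := by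
    ext ⟨u, w⟩
    simp only [SetLike.mem_coe, Set.mem_iInter]
    exact h.mem_left_iff u w
  rw [this]
  exact isClosed_iInter fun v => isClosed_iInter fun z => isClosed_iInter fun _ =>
    isClosed_eq (by fun_prop) (by fun_prop)

/-- A closed operator that is bounded below and whose range has trivial orthogonal complement is
boundedly invertible. The inverse is obtained by inverting the projection of the graph to the
second component. -/
theorem isRegularPoint_zero_of_bddBelow [CompleteSpace H] {T : H →ₗ.[ℂ] H}
    (hT : IsClosed (T.graph : Set (H × H))) {c : ℝ} (hc : 0 < c)
    (hbdd : ∀ x y, (x, y) ∈ T.graph → c * ‖x‖ ≤ ‖y‖)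
    (horth : ∀ y, (∀ x z, (x, z) ∈ T.graph → inner ℂ z y = 0) → y = 0) :
    IsRegularPoint T 0 := by
  have : CompleteSpace T.graph := hT.completeSpace_coe
  let f : T.graph →L[ℂ] H := (ContinuousLinearMap.snd ℂ H H).comp T.graph.subtypeL
  have hf : ∀ p : T.graph, f p = p.1.2 := fun _ => rfl
  have hanti : AntilipschitzWith (Real.toNNReal (max c⁻¹ 1)) f := by
    refine f.antilipschitz_of_bound fun p => ?_
    rw [Real.coe_toNNReal _ (by positivity), hf]
    have h1 := hbdd p.1.1 p.1.2 p.2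
    change max ‖p.1.1‖ ‖p.1.2‖ ≤ _
    refine max_le ?_ ?_
    · calc ‖p.1.1‖ = c⁻¹ * (c * ‖p.1.1‖) := by field_simp
        _ ≤ c⁻¹ * ‖p.1.2‖ := by gcongr
        _ ≤ _ := by gcongr; exact le_max_left _ _
    · exact le_mul_of_one_le_left (norm_nonneg _) (le_max_right _ _)
  have hclosed : IsClosed (f.range : Set H) := hanti.isClosed_range f.uniformContinuous
  have hker : f.ker = ⊥ := LinearMap.ker_eq_bot.2 hanti.injective
  have hrange : f.range = ⊤ := by
    have : CompleteSpace f.range := hclosed.completeSpace_coe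
    rw [← Submodule.orthogonal_eq_bot_iff, Submodule.eq_bot_iff]
    intro y hy
    refine horth y fun x z hxz => ?_
    exact (Submodule.mem_orthogonal _ _).1 hy z ⟨⟨(x, z), hxz⟩, rfl⟩
  let e : T.graph ≃L[ℂ] H := ContinuousLinearEquiv.ofBijective f hker hrange
  have he : ∀ p : T.graph, e p = p.1.2 := fun _ => rfl
  refine ⟨(ContinuousLinearMap.fst ℂ H H).comp (T.graph.subtypeL.comp
    (e.symm : H →L[ℂ] T.graph)), fun y => ?_,
    fun u => ?_⟩
  · obtain ⟨u, h1, h2⟩ := (LinearPMap.mem_graph_iff T).1 (e.symm y).2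
    have h3 : (e.symm y).1.2 = y := by rw [← he, e.apply_symm_apply]
    have hR : ((ContinuousLinearMap.fst ℂ H H).comp (T.graph.subtypeL.comp
        (e.symm : H →L[ℂ] T.graph))) y = u := h1.symm
    refine ⟨hR ▸ u.2, ?_⟩
    rw [zero_smul, sub_zero]
    refine Eq.trans ?_ (h2.trans h3)
    congr 1
    exact Subtype.ext hR
  · rw [zero_smul, sub_zero]
    have h1 : e ⟨(u, T u), T.mem_graph u⟩ = T u := rfl
    have h2 : e.symm (T u) = ⟨(u, T u), T.mem_graph u⟩ := e.symm_apply_eq.2 h1.symm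
    change (e.symm (T u)).1.1 = u
    rw [h2]

end AdjointPairs

/-! ### Operator matrices with off-diagonal entries adjoint to each other -/

section MaxwellOp

theorem norm_fst_le {E : Type*} [NormedAddCommGroup E] (p : WithLp 2 (E × E)) : ‖p.fst‖ ≤ ‖p‖ := by
  have := WithLp.prod_norm_sq_eq_of_L2 p
  exact le_of_sq_le_sq (by nlinarith [sq_nonneg ‖p.snd‖]) (norm_nonneg _)

theorem norm_snd_le {E : Type*} [NormedAddCommGroup E] (p : WithLp 2 (E × E)) : ‖p.snd‖ ≤ ‖p‖ := by
  have := WithLp.prod_norm_sq_eq_of_L2 p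
  exact le_of_sq_le_sq (by nlinarith [sq_nonneg ‖p.fst‖]) (norm_nonneg _)

variable {H : Type*} [NormedAddCommGroup H] [InnerProductSpace ℂ H]

/-- The operator matrix `(a, iB; -iA, d)` with bounded diagonal entries. -/
noncomputable def maxwellOp (A B : H →ₗ.[ℂ] H) (a d : H →L[ℂ] H) :
    WithLp 2 (H × H) →ₗ.[ℂ] WithLp 2 (H × H) :=
  blockOp (a.toLinearMap.toPMap ⊤) (Complex.I • B) (-(Complex.I • A)) (d.toLinearMap.toPMap ⊤)

variable {A B : H →ₗ.[ℂ] H} {a d : H →L[ℂ] H}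

theorem mem_graph_maxwellOp {p q : WithLp 2 (H × H)} :
    (p, q) ∈ (maxwellOp A B a d).graph ↔ ∃ w z, (p.fst, w) ∈ A.graph ∧ (p.snd, z) ∈ B.graph ∧
      q.fst = a p.fst + Complex.I • z ∧ q.snd = -(Complex.I • w) + d p.snd := by
  constructor
  · intro h
    obtain ⟨x, rfl, rfl⟩ := (LinearPMap.mem_graph_iff _).1 h
    exact ⟨_, _, A.mem_graph ⟨_, x.2.1.2⟩, B.mem_graph ⟨_, x.2.2.1⟩, rfl, rfl⟩
  · rintro ⟨w, z, hw, hz, h1, h2⟩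
    obtain ⟨u, hu, rfl⟩ := (LinearPMap.mem_graph_iff _).1 hw
    obtain ⟨v, hv, rfl⟩ := (LinearPMap.mem_graph_iff _).1 hz
    have hp : p ∈ (maxwellOp A B a d).domain :=
      ⟨⟨trivial, A.mem_domain_of_mem_graph hw⟩,
        B.mem_domain_of_mem_graph hz, trivial⟩
    refine (LinearPMap.mem_graph_iff _).2 ⟨⟨p, hp⟩, rfl, ?_⟩
    have e1 : u = ⟨p.fst, hp.1.2⟩ := Subtype.ext hu
    have e2 : v = ⟨p.snd, hp.2.1⟩ := Subtype.ext hv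
    subst e1 e2
    refine WithLp.ofLp_injective 2 (Prod.ext ?_ ?_)
    · exact h1.symm
    · exact h2.symm

theorem isClosed_graph_maxwellOp (hA : IsClosed (A.graph : Set (H × H)))
    (hB : IsClosed (B.graph : Set (H × H))) :
    IsClosed ((maxwellOp A B a d).graph : Set (WithLp 2 (H × H) × WithLp 2 (H × H))) := by
  have : ((maxwellOp A B a d).graph : Set (WithLp 2 (H × H) × WithLp 2 (H × H))) =
      (fun x => (x.1.fst, Complex.I • (x.2.snd - d x.1.snd))) ⁻¹' (A.graph : Set (H × H)) ∩
      (fun x => (x.1.snd, -(Complex.I • (x.2.fst - a x.1.fst)))) ⁻¹' (B.graph : Set (H × H)) := by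
    ext ⟨p, q⟩
    simp only [SetLike.mem_coe, mem_graph_maxwellOp, Set.mem_inter_iff, Set.mem_preimage]
    constructor
    · rintro ⟨w, z, hw, hz, h1, h2⟩
      rw [h1, h2]
      refine ⟨?_, ?_⟩
      · convert hw using 2; simp [smul_smul]
      · convert hz using 2; simp [smul_smul]
    · rintro ⟨hw, hz⟩
      exact ⟨_, _, hw, hz, by simp [smul_smul], by simp [smul_smul]⟩
  rw [this]
  refine (hA.preimage ?_).inter (hB.preimage ?_)
  · have h1 : Continuous fun x : WithLp 2 (H × H) => x.fst := WithLp.continuous_fst ..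
    have h2 : Continuous fun x : WithLp 2 (H × H) => x.snd := WithLp.continuous_snd ..
    fun_prop
  · have h1 : Continuous fun x : WithLp 2 (H × H) => x.fst := WithLp.continuous_fst ..
    have h2 : Continuous fun x : WithLp 2 (H × H) => x.snd := WithLp.continuous_snd ..
    fun_prop

/-- The orthogonal complement of the range of `(a, iB; -iA, d)` is contained in the kernel of
`(a*, iB; -iA, d*)`. -/
theorem mem_graph_maxwellOp_adjoint [CompleteSpace H] (h : IsAdjointPair A B)
    {y : WithLp 2 (H × H)}
    (hy : ∀ p q, (p, q) ∈ (maxwellOp A B a d).graph → inner ℂ q y = 0) :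
    (y, 0) ∈ (maxwellOp A B a.adjoint d.adjoint).graph := by
  have hA0 : ((0 : H), (0 : H)) ∈ A.graph := A.graph.zero_mem
  have hB0 : ((0 : H), (0 : H)) ∈ B.graph := B.graph.zero_mem
  refine mem_graph_maxwellOp.2 ⟨-(Complex.I • d.adjoint y.snd), Complex.I • a.adjoint y.fst,
    (h.mem_left_iff _ _).2 fun v z hz => ?_, (h.mem_right_iff _ _).2 fun u w hw => ?_, ?_, ?_⟩
  · have := hy (WithLp.toLp 2 (0, v)) (WithLp.toLp 2 (Complex.I • z, d v))
      (mem_graph_maxwellOp.2 ⟨0, z, hA0, hz, by simp, by simp⟩)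
    rw [WithLp.prod_inner_apply] at this
    change inner ℂ (Complex.I • z) y.fst + inner ℂ (d v) y.snd = 0 at this
    simp only [inner_smul_left, Complex.conj_I] at this
    rw [inner_neg_right, inner_smul_right, ContinuousLinearMap.adjoint_inner_right]
    linear_combination Complex.I * this + inner ℂ z y.fst * Complex.I_mul_I
  · have := hy (WithLp.toLp 2 (u, 0)) (WithLp.toLp 2 (a u, -(Complex.I • w)))
      (mem_graph_maxwellOp.2 ⟨w, 0, hw, hB0, by simp, by simp⟩)
    rw [WithLp.prod_inner_apply] at this
    change inner ℂ (a u) y.fst + inner ℂ (-(Complex.I • w)) y.snd = 0 at this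
    simp only [inner_neg_left, inner_smul_left, Complex.conj_I] at this
    rw [inner_smul_right, ContinuousLinearMap.adjoint_inner_right]
    linear_combination -Complex.I * this + inner ℂ w y.snd * Complex.I_mul_I
  · simp [smul_smul]
  · simp [smul_smul]

theorem isRegularPoint_maxwellOp [CompleteSpace H] (h : IsAdjointPair A B) {c c' : ℝ}
    (hc : 0 < c) (hc' : 0 < c')
    (hT : ∀ p q, (p, q) ∈ (maxwellOp A B a d).graph → c * ‖p‖ ≤ ‖q‖)
    (hT' : ∀ p q, (p, q) ∈ (maxwellOp A B a.adjoint d.adjoint).graph → c' * ‖p‖ ≤ ‖q‖) :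
    IsRegularPoint (maxwellOp A B a d) 0 := by
  refine isRegularPoint_zero_of_bddBelow
    (isClosed_graph_maxwellOp h.isClosed_graph_left h.symm.isClosed_graph_left) hc hT
    fun y hy => ?_
  have := hT' y 0 (mem_graph_maxwellOp_adjoint h hy)
  rw [norm_zero] at this
  exact norm_le_zero_iff.1 (nonpos_of_mul_nonpos_right this hc')

/-- The off-diagonal part drops out of `(f, u) - conj (g, v)` for `(f, g) = T (u, v)`. -/
theorem bddBelow_of_quadratic (h : IsAdjointPair A B) {δ : ℝ}
    (hδ : ∀ u v, δ * (‖u‖ ^ 2 + ‖v‖ ^ 2) ≤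
      ‖inner ℂ u (a u) - (starRingEnd ℂ) (inner ℂ v (d v))‖)
    (p q : WithLp 2 (H × H)) (hpq : (p, q) ∈ (maxwellOp A B a d).graph) :
    δ / 2 * ‖p‖ ≤ ‖q‖ := by
  obtain ⟨w, z, hw, hz, h1, h2⟩ := mem_graph_maxwellOp.1 hpq
  have key : inner ℂ p.fst q.fst - (starRingEnd ℂ) (inner ℂ p.snd q.snd) =
      inner ℂ p.fst (a p.fst) - (starRingEnd ℂ) (inner ℂ p.snd (d p.snd)) := by
    rw [h1, h2]
    simp only [inner_add_right, inner_neg_right, inner_smul_right, map_add, map_neg, map_mul,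
      Complex.conj_I, inner_conj_symm, h.inner_eq hw hz]
    ring
  have h3 := hδ p.fst p.snd
  rw [← key, ← WithLp.prod_norm_sq_eq_of_L2] at h3
  have h4 : ‖inner ℂ p.fst q.fst - (starRingEnd ℂ) (inner ℂ p.snd q.snd)‖ ≤ 2 * (‖p‖ * ‖q‖) := by
    refine (norm_sub_le _ _).trans ?_
    rw [RCLike.norm_conj, two_mul]
    refine add_le_add ((norm_inner_le_norm _ _).trans ?_) ((norm_inner_le_norm _ _).trans ?_)
    · exact mul_le_mul (norm_fst_le p) (norm_fst_le q) (norm_nonneg _) (norm_nonneg _)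
    · exact mul_le_mul (norm_snd_le p) (norm_snd_le q) (norm_nonneg _) (norm_nonneg _)
  rcases (norm_nonneg p).eq_or_lt with h0 | h0
  · rw [← h0, mul_zero]; exact norm_nonneg _
  · refine le_of_mul_le_mul_right ?_ h0
    linarith

theorem isRegularPoint_of_quadratic [CompleteSpace H] (h : IsAdjointPair A B) {δ : ℝ} (hδ0 : 0 < δ)
    (hδ : ∀ u v, δ * (‖u‖ ^ 2 + ‖v‖ ^ 2) ≤
      ‖inner ℂ u (a u) - (starRingEnd ℂ) (inner ℂ v (d v))‖) :
    IsRegularPoint (maxwellOp A B a d) 0 := by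
  refine isRegularPoint_maxwellOp h (half_pos hδ0) (half_pos hδ0) (bddBelow_of_quadratic h hδ)
    (bddBelow_of_quadratic h fun u v => ?_)
  rw [ContinuousLinearMap.adjoint_inner_right, ContinuousLinearMap.adjoint_inner_right,
    ← inner_conj_symm (a u), ← inner_conj_symm (d v), ← map_sub, RCLike.norm_conj]
  exact hδ u v

/-- If the quadratic form `(a u, u) - (e A u, A u)` of the Schur complement, `e = d⁻¹`, is bounded
away from zero, then `(a, iB; -iA, d)` is bounded below. The bound on `e` makes the form
control the graph norm of `A`. -/
theorem bddBelow_of_form (h : IsAdjointPair A B) {e : H →L[ℂ] H} (he : ∀ v, e (d v) = v)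
    {c δ : ℝ} (hc : 0 < c) (hδ : 0 < δ) (hec : ∀ w, c * ‖w‖ ^ 2 ≤ ‖inner ℂ w (e w)‖)
    (hform : ∀ u w, (u, w) ∈ A.graph →
      δ * ‖u‖ ^ 2 ≤ ‖inner ℂ u (a u) - inner ℂ w (e w)‖) :
    ∃ k, 0 < k ∧ ∀ p q, (p, q) ∈ (maxwellOp A B a d).graph → k * ‖p‖ ≤ ‖q‖ := by
  -- The constants below follow the estimates `‖u‖² ≤ |form| / δ`, `‖w‖² ≤ C₁ |form|`.
  set C₁ : ℝ := (1 + ‖a‖ / δ) / c with hC₁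
  set C₂ : ℝ := (1 / δ + C₁) * (1 + ‖e‖) with hC₂
  have hC₁0 : 0 < C₁ := by positivity
  have hC₂0 : 0 < C₂ := by positivity
  set C₃ : ℝ := 2 * C₂ + ‖e‖ * (1 + 2 * C₂) with hC₃
  have hC₃0 : 0 < C₃ := by positivity
  refine ⟨(2 * C₃ + 2 * C₂)⁻¹, by positivity, fun p q hpq => ?_⟩
  obtain ⟨w, z, hw, hz, h1, h2⟩ := mem_graph_maxwellOp.1 hpq
  set u := p.fst
  set v := p.snd
  have hv : v = e (q.snd + Complex.I • w) := by
    rw [h2, show -(Complex.I • w) + d v + Complex.I • w = d v by abel, he]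
  set F := inner ℂ u (a u) - inner ℂ w (e w) with hF
  have hkey : F = inner ℂ u q.fst - Complex.I * inner ℂ w (e q.snd) := by
    have h3 : inner ℂ u z = inner ℂ w (e q.snd) + Complex.I * inner ℂ w (e w) := by
      rw [← h.inner_eq hw hz, hv, map_add, map_smul, inner_add_right, inner_smul_right]
    rw [h1, inner_add_right, inner_smul_right, h3, hF]
    linear_combination -inner ℂ w (e w) * Complex.I_mul_I
  have hFq : ‖F‖ ≤ (‖u‖ + ‖w‖) * (1 + ‖e‖) * ‖q‖ := by
    rw [hkey]
    refine (norm_sub_le _ _).trans ?_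
    rw [norm_mul, Complex.norm_I, one_mul]
    have t1 : ‖inner ℂ u q.fst‖ ≤ ‖u‖ * ‖q‖ :=
      (norm_inner_le_norm _ _).trans (by gcongr; exact norm_fst_le q)
    have t2 : ‖inner ℂ w (e q.snd)‖ ≤ ‖w‖ * (‖e‖ * ‖q‖) :=
      (norm_inner_le_norm _ _).trans (by
        gcongr
        exact (e.le_opNorm _).trans (by gcongr; exact norm_snd_le q))
    have t3 : 0 ≤ ‖u‖ * ‖e‖ * ‖q‖ := by positivity
    have t4 : 0 ≤ ‖w‖ * ‖q‖ := by positivity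
    nlinarith
  have hu2 : ‖u‖ ^ 2 ≤ 1 / δ * ‖F‖ := by
    have := hform u w hw
    rw [one_div, ← div_eq_inv_mul, le_div_iff₀ hδ]
    linarith
  have hw2 : ‖w‖ ^ 2 ≤ C₁ * ‖F‖ := by
    have h3 : ‖inner ℂ w (e w)‖ ≤ ‖F‖ + ‖a‖ * ‖u‖ ^ 2 := by
      have : inner ℂ w (e w) = inner ℂ u (a u) - F := by rw [hF]; ring
      rw [this]
      refine (norm_sub_le _ _).trans ?_
      have : ‖inner ℂ u (a u)‖ ≤ ‖u‖ * (‖a‖ * ‖u‖) :=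
        (norm_inner_le_norm _ _).trans (by gcongr; exact a.le_opNorm _)
      linarith
    have h4 : ‖a‖ * ‖u‖ ^ 2 ≤ ‖a‖ * (1 / δ * ‖F‖) := by gcongr
    have h5 := hec w
    have h6 : c * ‖w‖ ^ 2 ≤ (1 + ‖a‖ / δ) * ‖F‖ := by
      have : (1 + ‖a‖ / δ) * ‖F‖ = ‖F‖ + ‖a‖ * (1 / δ * ‖F‖) := by ring
      linarith
    rw [hC₁, div_mul_eq_mul_div, le_div_iff₀ hc]
    linarith
  have hN : ‖u‖ + ‖w‖ ≤ 2 * C₂ * ‖q‖ := by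
    rcases (add_nonneg (norm_nonneg u) (norm_nonneg w)).eq_or_lt with h0 | h0
    · rw [← h0]; positivity
    · refine le_of_mul_le_mul_right ?_ h0
      have h3 : (1 / δ + C₁) * ‖F‖ ≤ (1 / δ + C₁) * ((‖u‖ + ‖w‖) * (1 + ‖e‖) * ‖q‖) := by gcongr
      have h4 : (1 / δ + C₁) * ((‖u‖ + ‖w‖) * (1 + ‖e‖) * ‖q‖) = C₂ * ‖q‖ * (‖u‖ + ‖w‖) := by
        rw [hC₂]; ring
      nlinarith [sq_nonneg (‖u‖ - ‖w‖)]
  have hvn : ‖v‖ ≤ ‖e‖ * (‖q‖ + ‖w‖) := by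
    rw [hv]
    refine (e.le_opNorm _).trans ?_
    gcongr
    refine (norm_add_le _ _).trans ?_
    rw [norm_smul, Complex.norm_I, one_mul]
    gcongr
    exact norm_snd_le q
  have hp : ‖p‖ ≤ ‖u‖ + ‖v‖ := by
    have := WithLp.prod_norm_sq_eq_of_L2 p
    refine le_of_sq_le_sq ?_ (by positivity)
    nlinarith [mul_nonneg (norm_nonneg u) (norm_nonneg v)]
  have hu0 : ‖u‖ ≤ 2 * C₂ * ‖q‖ := by linarith [norm_nonneg w]
  have hw0 : ‖w‖ ≤ 2 * C₂ * ‖q‖ := by linarith [norm_nonneg u]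
  have hv0 : ‖v‖ ≤ ‖e‖ * (‖q‖ + 2 * C₂ * ‖q‖) := hvn.trans (by gcongr)
  rw [inv_mul_le_iff₀ (by positivity)]
  have : ‖e‖ * (‖q‖ + 2 * C₂ * ‖q‖) + 2 * C₂ * ‖q‖ = C₃ * ‖q‖ := by rw [hC₃]; ring
  have : 0 ≤ C₃ * ‖q‖ := by positivity
  have : 0 ≤ C₂ * ‖q‖ := by positivity
  linarith

theorem isRegularPoint_of_form [CompleteSpace H] (h : IsAdjointPair A B) {e : H →L[ℂ] H}
    (hed : e * d = 1) (hde : d * e = 1)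
    {c δ : ℝ} (hc : 0 < c) (hδ : 0 < δ) (hec : ∀ w, c * ‖w‖ ^ 2 ≤ ‖inner ℂ w (e w)‖)
    (hform : ∀ u w, (u, w) ∈ A.graph →
      δ * ‖u‖ ^ 2 ≤ ‖inner ℂ u (a u) - inner ℂ w (e w)‖) :
    IsRegularPoint (maxwellOp A B a d) 0 := by
  obtain ⟨k, hk, hT⟩ := bddBelow_of_form h (fun v => DFunLike.congr_fun hed v) hc hδ hec hform
  have hed' : e.adjoint * d.adjoint = 1 := by
    rw [← ContinuousLinearMap.star_eq_adjoint, ← ContinuousLinearMap.star_eq_adjoint, ← star_mul,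
      hde, star_one]
  have hconj : ∀ (f : H →L[ℂ] H) (u : H),
      inner ℂ u (f.adjoint u) = (starRingEnd ℂ) (inner ℂ u (f u)) := fun f u => by
    rw [ContinuousLinearMap.adjoint_inner_right, inner_conj_symm]
  obtain ⟨k', hk', hT'⟩ := bddBelow_of_form (a := a.adjoint) (d := d.adjoint) h
    (fun v => DFunLike.congr_fun hed' v) hc hδ
    (fun w => by rw [hconj, RCLike.norm_conj]; exact hec w)
    (fun u w hw => by rw [hconj, hconj, ← map_sub, RCLike.norm_conj]; exact hform u w hw)
  exact isRegularPoint_maxwellOp h hk hk' hT hT'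

end MaxwellOp

/-! ### A core given by the Lax-Milgram lemma -/

section Core

variable {H : Type*} [NormedAddCommGroup H] [InnerProductSpace ℂ H] [CompleteSpace H]

/-- Let `m` be bounded with `s Im (m w, w) ≥ c ‖w‖²`. Then the natural domain
`{u ∈ dom A : m A u ∈ dom A*}` of `A* m A` is a core of `A`. The form
`(m A u, A u') + i s (u, u')` is coercive on `dom A`, so by the Lax-Milgram lemma the
solutions `u` of `A* m A u + i s u = f`, `f ∈ H`, are dense in `dom A` for the graph norm. -/
theorem graph_subset_closure_core {A B : H →ₗ.[ℂ] H} (h : IsAdjointPair A B) {m : H →L[ℂ] H}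
    {c s : ℝ} (hc : 0 < c) (hs : s ≠ 0) (hm : ∀ w, c * ‖w‖ ^ 2 ≤ s * (inner ℂ w (m w)).im)
    {x : H × H} (hx : x ∈ A.graph) :
    x ∈ closure {p : H × H | p ∈ A.graph ∧ ∃ z, (m p.2, z) ∈ B.graph} := by
  let V : Submodule ℂ (WithLp 2 (H × H)) := A.graph.comap
    (WithLp.linearEquiv 2 ℂ (H × H) : WithLp 2 (H × H) →ₗ[ℂ] H × H)
  have hVcl : IsClosed (V : Set (WithLp 2 (H × H))) :=
    h.isClosed_graph_left.preimage (WithLp.prod_continuous_ofLp 2 H H)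
  have : CompleteSpace V := hVcl.completeSpace_coe
  let N : WithLp 2 (H × H) →L[ℂ] WithLp 2 (H × H) :=
    ((WithLp.prodContinuousLinearEquiv 2 ℂ H H).symm : H × H →L[ℂ] WithLp 2 (H × H)).comp
      ((((Complex.I * s) • ContinuousLinearMap.id ℂ H).prodMap m).comp
        (WithLp.prodContinuousLinearEquiv 2 ℂ H H : WithLp 2 (H × H) →L[ℂ] H × H))
  have hN : ∀ p q : WithLp 2 (H × H), inner ℂ q (N p) =
      Complex.I * s * inner ℂ q.fst p.fst + inner ℂ q.snd (m p.snd) := fun p q => by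
    rw [WithLp.prod_inner_apply, ← inner_smul_right]; rfl
  have hcoer : ∀ p, min c (s ^ 2) / |s| * ‖p‖ ^ 2 ≤ ‖inner ℂ p (N p)‖ := fun p => by
    have h1 : s * (inner ℂ p (N p)).im = s ^ 2 * ‖p.fst‖ ^ 2 + s * (inner ℂ p.snd (m p.snd)).im := by
      have h0 : (inner ℂ p.fst p.fst).re = ‖p.fst‖ ^ 2 := inner_self_eq_norm_sq (𝕜 := ℂ) p.fst
      rw [hN, mul_assoc, Complex.add_im, Complex.I_mul_im, Complex.re_ofReal_mul, h0]
      ring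
    have h2 : s * (inner ℂ p (N p)).im ≤ |s| * ‖inner ℂ p (N p)‖ :=
      (le_abs_self _).trans (by rw [abs_mul]; gcongr; exact Complex.abs_im_le_norm _)
    have h3 : min c (s ^ 2) * ‖p.fst‖ ^ 2 ≤ s ^ 2 * ‖p.fst‖ ^ 2 := by gcongr; exact min_le_right _ _
    have h4 : min c (s ^ 2) * ‖p.snd‖ ^ 2 ≤ c * ‖p.snd‖ ^ 2 := by gcongr; exact min_le_left _ _
    have h5 := hm p.snd
    rw [div_mul_eq_mul_div, div_le_iff₀ (abs_pos.2 hs), WithLp.prod_norm_sq_eq_of_L2]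
    linarith
  let f : V →L[ℂ] V := V.orthogonalProjectionOnto.comp (N.comp V.subtypeL)
  have hf : ∀ x y : V, inner ℂ y (f x) = inner ℂ (y : WithLp 2 (H × H)) (N x) := fun x y => by
    exact Submodule.inner_orthogonalProjectionOnto_eq_of_mem_left y (N x)
  have hk : 0 < min c (s ^ 2) / |s| :=
    div_pos (lt_min hc (by positivity)) (abs_pos.2 hs)
  have hfu : IsUnit f := by
    refine ContinuousLinearMap.isUnit_of_forall_le_norm_inner_map f (c := ⟨_, hk.le⟩) hk fun x => ?_
    rw [← inner_conj_symm, RCLike.norm_conj, hf, mul_comm]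
    exact hcoer x
  have hfb := ContinuousLinearMap.isUnit_iff_bijective.1 hfu
  let e : V ≃L[ℂ] V := ContinuousLinearEquiv.ofBijective f
    (LinearMap.ker_eq_bot.2 hfb.1) (LinearMap.range_eq_top.2 hfb.2)
  let J : V →L[ℂ] H := (ContinuousLinearMap.fst ℂ H H).comp
    ((WithLp.prodContinuousLinearEquiv 2 ℂ H H : WithLp 2 (H × H) →L[ℂ] H × H).comp V.subtypeL)
  have hJ : ∀ x : V, J x = (x : WithLp 2 (H × H)).fst := fun _ => rfl
  have hJd : DenseRange J.adjoint := by
    have h1 : J.adjoint.rangeᗮ = ⊥ := by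
      rw [ContinuousLinearMap.orthogonal_range, ContinuousLinearMap.adjoint_adjoint,
        LinearMap.ker_eq_bot']
      intro x hx
      have h2 : (x : WithLp 2 (H × H)).snd = 0 := A.graph_fst_eq_zero_snd x.2 hx
      exact Subtype.ext (WithLp.ofLp_injective 2 (Prod.ext hx h2))
    have h2 := Submodule.topologicalClosure_eq_top_iff.2 h1
    exact (Submodule.dense_iff_topologicalClosure_eq_top).2 h2
  have hd : DenseRange fun y => e.symm (J.adjoint y) :=
    e.symm.surjective.denseRange.comp hJd e.symm.continuous
  have hφ : Continuous fun x : V => (x : WithLp 2 (H × H)).ofLp :=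
    (WithLp.prod_continuous_ofLp 2 H H).comp continuous_subtype_val
  refine closure_mono ?_ (mem_closure_image hφ.continuousAt
    (hd (⟨WithLp.toLp 2 x, hx⟩ : V)))
  rintro _ ⟨_, ⟨y, rfl⟩, rfl⟩
  set v := e.symm (J.adjoint y) with hv
  refine ⟨v.2, y - (Complex.I * s) • (v : WithLp 2 (H × H)).fst, (h.mem_right_iff _ _).2
    fun u w huw => ?_⟩
  have h1 : f v = J.adjoint y := e.apply_symm_apply _
  have h2 := hf v ⟨WithLp.toLp 2 (u, w), huw⟩
  rw [h1, ContinuousLinearMap.adjoint_inner_right, hN] at h2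
  rw [inner_sub_right, inner_smul_right]
  exact (sub_eq_of_eq_add' h2).symm

end Core

/-! ### The scalar equation for the quadratic forms -/

section Scalar

/-- The equation `(a u, u) = conj (d v, v)`, written for the numbers `U = ‖u‖²`, `V = ‖v‖²`,
`E = ‖θₑ u‖²`, `F = ‖θₘ v‖²`. With `e = E / |ω + iγₑ|²` and `f = F / |ω + iγₘ|²`, its imaginary part
is `(Im ω) (1 + e + f) = -(γₑ e + γₘ f)`, and its real part is `U - e = V - f` unless `Re ω = 0`. -/
theorem enclosure_of_quadratic_eq {γe γm Te Tm U V E F : ℝ} {ω : ℂ} (hγe : 0 < γe) (hγm : 0 < γm)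
    (hωe : ω + Complex.I * γe ≠ 0) (hωm : ω + Complex.I * γm ≠ 0)
    (hU : 0 ≤ U) (hV : 0 ≤ V) (hUV : U + V = 1) (hE : 0 ≤ E) (hET : E ≤ Te * U)
    (hF : 0 ≤ F) (hFT : F ≤ Tm * V) (hTe : 0 ≤ Te) (hTm : 0 ≤ Tm)
    (h0 : -ω * U + E / (ω + Complex.I * γe) -
      (starRingEnd ℂ) (-ω * V + F / (ω + Complex.I * γm)) = 0) :
    0 ≤ -ω.im ∧ -ω.im ≤ max γe γm ∧ (ω.im = 0 → E = 0 ∧ F = 0) ∧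
      (ω.re ≠ 0 → -((γe + γm) / 2) ≤ ω.im ∧ -ω.im ≤ (γe * Te + γm * Tm) / ω.re ^ 2) := by
  obtain ⟨x, y⟩ := ω
  have hse : 0 < x ^ 2 + (y + γe) ^ 2 := by
    have := Complex.normSq_pos.2 hωe
    simpa [Complex.normSq_apply, ← sq] using this
  have hsm : 0 < x ^ 2 + (y + γm) ^ 2 := by
    have := Complex.normSq_pos.2 hωm
    simpa [Complex.normSq_apply, ← sq] using this
  obtain ⟨e, he⟩ : ∃ e, e = E / (x ^ 2 + (y + γe) ^ 2) := ⟨_, rfl⟩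
  obtain ⟨f, hf⟩ : ∃ f, f = F / (x ^ 2 + (y + γm) ^ 2) := ⟨_, rfl⟩
  have hEe : E = e * (x ^ 2 + (y + γe) ^ 2) := by rw [he]; field_simp
  have hFf : F = f * (x ^ 2 + (y + γm) ^ 2) := by rw [hf]; field_simp
  have he0 : 0 ≤ e := by rw [he]; positivity
  have hf0 : 0 ≤ f := by rw [hf]; positivity
  have hre := congrArg Complex.re h0
  have him := congrArg Complex.im h0
  simp [Complex.div_re, Complex.div_im, Complex.normSq_apply, ← sq] at hre him
  have hre' : x * (-U + e) = x * (-V + f) := by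
    rw [he, hf]
    linear_combination hre
  have him' : y * (1 + e + f) = -(γe * e + γm * f) := by
    rw [← hUV, he, hf]
    linear_combination -him
  have hs : 0 < 1 + e + f := by positivity
  have hγe' : γe ≤ max γe γm := le_max_left _ _
  have hγm' : γm ≤ max γe γm := le_max_right _ _
  have hy : 0 ≤ -y := by
    by_contra hcon
    have : 0 < y * (1 + e + f) := mul_pos (by linarith) hs
    have : 0 ≤ γe * e + γm * f := by positivity
    linarith
  refine ⟨hy, ?_, fun h => ?_, fun hx => ⟨?_, ?_⟩⟩
  · change -y ≤ _
    refine le_of_mul_le_mul_right ?_ hs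
    have h1 : γe * e ≤ max γe γm * e := by gcongr
    have h2 : γm * f ≤ max γe γm * f := by gcongr
    have h3 : 0 < max γe γm := hγe.trans_le hγe'
    linarith
  · change y = 0 at h
    rw [h, zero_mul] at him'
    have h1 : 0 ≤ γe * e := by positivity
    have h2 : 0 ≤ γm * f := by positivity
    have h3 : e = 0 := by
      have : γe * e = 0 := by linarith
      exact (mul_eq_zero.1 this).resolve_left hγe.ne'
    have h4 : f = 0 := by
      have : γm * f = 0 := by linarith
      exact (mul_eq_zero.1 this).resolve_left hγm.ne'
    rw [hEe, hFf, h3, h4]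
    simp
  · change _ ≤ y
    have hd := mul_left_cancel₀ hx hre'
    have h1 : e - f ≤ 1 := by linarith
    have h2 : f - e ≤ 1 := by linarith
    have h3 : γe * (e - f) ≤ γe * 1 := by gcongr
    have h4 : γm * (f - e) ≤ γm * 1 := by gcongr
    refine le_of_mul_le_mul_right ?_ hs
    rw [him']
    linarith
  · change -y ≤ _ / x ^ 2
    change x ≠ 0 at hx
    rw [le_div_iff₀ (by positivity)]
    have h1 : -y ≤ γe * e + γm * f := by nlinarith [mul_nonneg hy (add_nonneg he0 hf0)]
    have h2 : e * x ^ 2 ≤ Te := by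
      have : 0 ≤ e * (y + γe) ^ 2 := by positivity
      have : Te * U ≤ Te * 1 := by gcongr; linarith
      linarith
    have h3 : f * x ^ 2 ≤ Tm := by
      have : 0 ≤ f * (y + γm) ^ 2 := by positivity
      have : Tm * V ≤ Tm * 1 := by gcongr; linarith
      linarith
    calc -y * x ^ 2 ≤ (γe * e + γm * f) * x ^ 2 := by gcongr
      _ = γe * (e * x ^ 2) + γm * (f * x ^ 2) := by ring
      _ ≤ γe * Te + γm * Tm := by gcongr

/-- A linear expression in `(U, V, E, F)` that has no zero on the slice `U + V = 1` of the cone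
`Le U ≤ E ≤ Te U`, `Lm V ≤ F ≤ Tm V` is bounded below on this cone by a multiple of `U + V`,
because the slice is compact. -/
theorem exists_lower_bound_on_cone (z₁ z₂ z₃ z₄ : ℂ) {Le Lm Te Tm : ℝ}
    (hne : ∀ U V E F : ℝ, 0 ≤ U → 0 ≤ V → U + V = 1 → 0 ≤ E → Le * U ≤ E → E ≤ Te * U →
      0 ≤ F → Lm * V ≤ F → F ≤ Tm * V → z₁ * U + z₂ * V + z₃ * E + z₄ * F ≠ 0) :
    ∃ δ : ℝ, 0 < δ ∧ ∀ U V E F : ℝ, 0 ≤ U → 0 ≤ V → 0 ≤ E → Le * U ≤ E → E ≤ Te * U →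
      0 ≤ F → Lm * V ≤ F → F ≤ Tm * V → δ * (U + V) ≤ ‖z₁ * U + z₂ * V + z₃ * E + z₄ * F‖ := by
  let K : Set (ℝ × ℝ × ℝ × ℝ) := {x | 0 ≤ x.1 ∧ 0 ≤ x.2.1 ∧ x.1 + x.2.1 = 1 ∧ 0 ≤ x.2.2.1 ∧
    Le * x.1 ≤ x.2.2.1 ∧ x.2.2.1 ≤ Te * x.1 ∧ 0 ≤ x.2.2.2 ∧ Lm * x.2.1 ≤ x.2.2.2 ∧
    x.2.2.2 ≤ Tm * x.2.1}
  let G : ℝ × ℝ × ℝ × ℝ → ℂ := fun x => z₁ * x.1 + z₂ * x.2.1 + z₃ * x.2.2.1 + z₄ * x.2.2.2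
  have hKc : IsCompact K := by
    have hcl : IsClosed K := by
      simp only [K, Set.ofPred_and]
      repeat' first
        | apply IsClosed.inter
        | exact isClosed_le (by fun_prop) (by fun_prop)
        | exact isClosed_eq (by fun_prop) (by fun_prop)
    refine (isCompact_Icc (a := ((0, 0, 0, 0) : ℝ × ℝ × ℝ × ℝ))
      (b := (1, 1, |Te|, |Tm|))).of_isClosed_subset hcl ?_
    rintro ⟨U, V, E, F⟩ ⟨h1, h2, h3, h4, -, h5, h6, -, h7⟩
    dsimp only at h1 h2 h3 h4 h5 h6 h7
    have hE : E ≤ |Te| := by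
      have : Te * U ≤ |Te| * U := by gcongr; exact le_abs_self _
      have : |Te| * U ≤ |Te| * 1 := by gcongr; linarith
      linarith
    have hF : F ≤ |Tm| := by
      have : Tm * V ≤ |Tm| * V := by gcongr; exact le_abs_self _
      have : |Tm| * V ≤ |Tm| * 1 := by gcongr; linarith
      linarith
    exact ⟨⟨h1, h2, h4, h6⟩, ⟨by dsimp only; linarith, by dsimp only; linarith, hE, hF⟩⟩
  have hGc : Continuous G := by fun_prop
  obtain ⟨δ, hδ, hmin⟩ : ∃ δ : ℝ, 0 < δ ∧ ∀ x ∈ K, δ ≤ ‖G x‖ := by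
    rcases K.eq_empty_or_nonempty with h0 | h0
    · exact ⟨1, one_pos, by simp [h0]⟩
    · obtain ⟨x, hx, hxm⟩ := hKc.exists_isMinOn h0 hGc.norm.continuousOn
      refine ⟨‖G x‖, norm_pos_iff.2 ?_, hxm⟩
      obtain ⟨h1, h2, h3, h4, h5, h6, h7, h8, h9⟩ := hx
      exact hne _ _ _ _ h1 h2 h3 h4 h5 h6 h7 h8 h9
  refine ⟨δ, hδ, fun U V E F h1 h2 h3 h4 h5 h6 h7 h8 => ?_⟩
  rcases (add_nonneg h1 h2).eq_or_lt with h0 | h0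
  · rw [← h0, mul_zero]; exact norm_nonneg _
  · set s := U + V with hs
    have h9 := hmin (U / s, V / s, E / s, F / s)
      ⟨by positivity, by positivity, by
        change U / s + V / s = 1
        rw [← add_div, ← hs, div_self h0.ne'], by positivity,
        by
          change Le * (U / s) ≤ E / s
          rw [← mul_div_assoc]; gcongr,
        by
          change E / s ≤ Te * (U / s)
          rw [← mul_div_assoc]; gcongr,
        by positivity,
        by
          change Lm * (V / s) ≤ F / s
          rw [← mul_div_assoc]; gcongr,
        by
          change F / s ≤ Tm * (V / s)
          rw [← mul_div_assoc]; gcongr⟩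
    have h10 : z₁ * U + z₂ * V + z₃ * E + z₄ * F = s * G (U / s, V / s, E / s, F / s) := by
      have : (s : ℂ) ≠ 0 := Complex.ofReal_ne_zero.2 h0.ne'
      simp only [G, Complex.ofReal_div]
      field_simp
    rw [h10, norm_mul, Complex.norm_real, Real.norm_of_nonneg h0.le, mul_comm]
    gcongr

end Scalar

/-! ### Numerical ranges and Schur complements -/

section NumericalRange

variable {H : Type*} [NormedAddCommGroup H] [InnerProductSpace ℂ H]

theorem inner_mem_numRange {T : H →ₗ.[ℂ] H} {u y : H} (h : (u, y) ∈ T.graph) (hu : ‖u‖ = 1) :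
    inner ℂ u y ∈ numRange T := by
  obtain ⟨x, rfl, rfl⟩ := (LinearPMap.mem_graph_iff T).1 h
  exact ⟨x, hu, rfl⟩

theorem exists_lower_bound_of_zero_notMem_closure_numRange {T : H →ₗ.[ℂ] H}
    (h0 : (0 : ℂ) ∉ closure (numRange T)) :
    ∃ δ : ℝ, 0 < δ ∧ ∀ u y, (u, y) ∈ T.graph → δ * ‖u‖ ^ 2 ≤ ‖inner ℂ u y‖ := by
  rw [Metric.mem_closure_iff] at h0
  push Not at h0
  obtain ⟨δ, hδ, hd⟩ := h0
  refine ⟨δ, hδ, fun u y huy => ?_⟩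
  rcases (norm_nonneg u).eq_or_lt with hu | hu
  · rw [← hu]; simp
  · set r : ℂ := ((‖u‖⁻¹ : ℝ) : ℂ) with hr
    have h1 : ‖r • u‖ = 1 := by
      rw [norm_smul, hr, Complex.norm_real, Real.norm_of_nonneg (by positivity),
        inv_mul_cancel₀ hu.ne']
    have h2 := hd _ (inner_mem_numRange (T.graph.smul_mem r huy) h1)
    simp only [inner_smul_left, inner_smul_right, dist_zero_left, norm_mul,
      RCLike.norm_conj] at h2
    rw [hr, Complex.norm_real, Real.norm_of_nonneg (by positivity)] at h2
    rw [← le_div_iff₀ (by positivity)]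
    refine h2.trans_eq ?_
    field_simp

/-- The graph of the Schur complement `B m A - q` with bounded `m` and `q`. -/
theorem mem_graph_schur {A B : H →ₗ.[ℂ] H} {m q : H →L[ℂ] H} {u w z : H}
    (hw : (u, w) ∈ A.graph) (hz : (m w, z) ∈ B.graph) :
    (u, z - q u) ∈ (pcomp B (pcomp (m.toLinearMap.toPMap ⊤) A) - q.toLinearMap.toPMap ⊤).graph := by
  obtain ⟨u, rfl, rfl⟩ := (LinearPMap.mem_graph_iff A).1 hw
  obtain ⟨v, hv, rfl⟩ := (LinearPMap.mem_graph_iff B).1 hz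
  have h1 : (u : H) ∈ (pcomp (m.toLinearMap.toPMap ⊤) A).domain := ⟨u.2, trivial⟩
  have h2 : (u : H) ∈ (pcomp B (pcomp (m.toLinearMap.toPMap ⊤) A)).domain :=
    ⟨h1, B.mem_domain_of_mem_graph hz⟩
  refine (LinearPMap.mem_graph_iff _).2 ⟨⟨u, h2, trivial⟩, rfl, ?_⟩
  rw [LinearPMap.sub_apply]
  change B ⟨m (A u), _⟩ - q u = B v - q u
  congr 2
  exact Subtype.ext hv.symm

/-- Let `Θ` be bounded with `Im (Θ z, z) = D ‖z‖²`, `D ≠ 0`, and inverse `m`. If `0` is not in the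
closure of the numerical range of the Schur complement `B m A + β⁻¹ a`, then
`(a, iB; -iA, -β⁻¹ Θ)` is boundedly invertible. -/
theorem isRegularPoint_of_zero_notMem_closure_numRange_schur [CompleteSpace H]
    {A B : H →ₗ.[ℂ] H} (h : IsAdjointPair A B) {a m Θ : H →L[ℂ] H} {β : ℂ} (hβ : β ≠ 0) {D : ℝ}
    (hD : D ≠ 0) (hΘ : ∀ z, (inner ℂ z (Θ z)).im = D * ‖z‖ ^ 2) (hmΘ : m * Θ = 1) (hΘm : Θ * m = 1)
    (h0 : (0 : ℂ) ∉ closure (numRange (pcomp B (pcomp (m.toLinearMap.toPMap ⊤) A) -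
      (-(β⁻¹ • a)).toLinearMap.toPMap ⊤))) :
    IsRegularPoint (maxwellOp A B a (-(β⁻¹ • Θ))) 0 := by
  obtain ⟨δ, hδ, hnum⟩ := exists_lower_bound_of_zero_notMem_closure_numRange h0
  set c : ℝ := D ^ 2 / (‖Θ‖ + 1) ^ 2 with hc
  have hc0 : 0 < c := by positivity
  have hm : ∀ w, c * ‖w‖ ^ 2 ≤ -D * (inner ℂ w (m w)).im := fun w => by
    have h1 : Θ (m w) = w := DFunLike.congr_fun hΘm w
    have h2 : (inner ℂ w (m w)).im = -(D * ‖m w‖ ^ 2) := by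
      rw [← hΘ (m w), h1, ← inner_conj_symm w (m w), Complex.conj_im]
    have h3 : ‖w‖ ≤ (‖Θ‖ + 1) * ‖m w‖ := by
      have := Θ.le_opNorm (m w)
      rw [h1] at this
      linarith [norm_nonneg (m w)]
    rw [h2, hc, div_mul_eq_mul_div, div_le_iff₀ (by positivity)]
    calc D ^ 2 * ‖w‖ ^ 2 ≤ D ^ 2 * ((‖Θ‖ + 1) * ‖m w‖) ^ 2 := by gcongr
      _ = _ := by ring
  have hform : ∀ u w, (u, w) ∈ A.graph →
      δ * ‖u‖ ^ 2 ≤ ‖inner ℂ w (m w) + β⁻¹ * inner ℂ u (a u)‖ := by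
    intro u w huw
    have hcl : IsClosed {p : H × H | δ * ‖p.1‖ ^ 2 ≤
        ‖inner ℂ p.2 (m p.2) + β⁻¹ * inner ℂ p.1 (a p.1)‖} :=
      isClosed_le (by fun_prop) (by fun_prop)
    refine closure_minimal ?_ hcl (graph_subset_closure_core h hc0 (neg_ne_zero.2 hD) hm huw)
    rintro ⟨u, w⟩ ⟨hw, z, hz⟩
    have h1 := hnum _ _ (mem_graph_schur (q := -(β⁻¹ • a)) hw hz)
    rw [inner_sub_right, ← h.inner_eq hw hz] at h1
    simpa [inner_smul_right] using h1
  refine isRegularPoint_of_form h (e := -(β • m)) (c := ‖β‖ * (c / |D|)) (δ := ‖β‖ * δ) ?_ ?_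
    (by positivity) (by positivity) (fun w => ?_) (fun u w hw => ?_)
  · rw [neg_mul_neg, smul_mul_smul_comm, hmΘ, mul_inv_cancel₀ hβ, one_smul]
  · rw [neg_mul_neg, smul_mul_smul_comm, hΘm, inv_mul_cancel₀ hβ, one_smul]
  · have h1 : -D * (inner ℂ w (m w)).im ≤ |D| * ‖inner ℂ w (m w)‖ :=
      (le_abs_self _).trans (by rw [abs_mul, abs_neg]; gcongr; exact Complex.abs_im_le_norm _)
    have h2 : c / |D| * ‖w‖ ^ 2 ≤ ‖inner ℂ w (m w)‖ := by
      rw [div_mul_eq_mul_div, div_le_iff₀ (abs_pos.2 hD)]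
      linarith [hm w]
    have h3 : ‖inner ℂ w ((-(β • m)) w)‖ = ‖β‖ * ‖inner ℂ w (m w)‖ := by
      simp [inner_smul_right]
    rw [h3, mul_assoc]
    gcongr
  · have h1 : inner ℂ u (a u) - inner ℂ w ((-(β • m)) w) =
        β * (inner ℂ w (m w) + β⁻¹ * inner ℂ u (a u)) := by
      simp only [neg_apply, smul_apply, inner_neg_right, inner_smul_right]
      field_simp
      ring
    rw [h1, norm_mul, mul_assoc]
    gcongr
    exact hform u w hw

end NumericalRange

/-! ### Adjointness of the two curl operators -/

section Curl

theorem mem_weakCurlGraph_iff {Ω : Set R3} {v z : L2 Ω} : (v, z) ∈ weakCurlGraph Ω ↔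
    ∀ u w, (u, w) ∈ testGraph Ω → inner ℂ w v = inner ℂ u z := by
  have key : ∀ {f : R3 → C3} {u v : L2 Ω}, u =ᵐ[volume.restrict Ω] f →
      inner ℂ u v = ∫ x in Ω, inner ℂ (f x) (v x) := by
    intro f u v huf
    rw [L2.inner_def]
    refine integral_congr_ae ?_
    filter_upwards [huf] with x hx
    rw [hx]
  constructor
  · rintro h u w ⟨φ, hφ, h1, h2⟩
    rw [key h1, key h2]
    exact h φ hφ
  · intro h φ hφ
    have := h hφ.memLp.toLp hφ.memLp_curlVec.toLp
      ⟨φ, hφ, hφ.memLp.coeFn_toLp, hφ.memLp_curlVec.coeFn_toLp⟩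
    rwa [key hφ.memLp.coeFn_toLp, key hφ.memLp_curlVec.coeFn_toLp] at this

/-- The closure of a linear relation is its second adjoint. -/
theorem mem_topologicalClosure_of_forall_adjoint {H : Type*} [NormedAddCommGroup H]
    [InnerProductSpace ℂ H] [CompleteSpace H] {G : Submodule ℂ (H × H)} {u w : H}
    (h : ∀ v z, (∀ u' w', (u', w') ∈ G → inner ℂ w' v = inner ℂ u' z) → inner ℂ z u = inner ℂ v w) :
    (u, w) ∈ G.topologicalClosure := by
  let e : WithLp 2 (H × H) ≃L[ℂ] H × H := WithLp.prodContinuousLinearEquiv 2 ℂ H H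
  let G' : Submodule ℂ (WithLp 2 (H × H)) := G.comap (e : WithLp 2 (H × H) →ₗ[ℂ] H × H)
  have h1 : WithLp.toLp 2 (u, w) ∈ G'ᗮᗮ := by
    rw [Submodule.mem_orthogonal]
    intro q hq
    rw [Submodule.mem_orthogonal] at hq
    have h2 := h q.snd (-q.fst) fun u' w' hu' => by
      have := hq (WithLp.toLp 2 (u', w')) hu'
      rw [WithLp.prod_inner_apply] at this
      rw [inner_neg_right]
      exact eq_neg_of_add_eq_zero_right this
    rw [inner_neg_left] at h2
    rw [WithLp.prod_inner_apply]
    change inner ℂ q.fst u + inner ℂ q.snd w = 0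
    rw [← h2, add_neg_cancel]
  rw [Submodule.orthogonal_orthogonal_eq_closure] at h1
  have h3 := mem_closure_image e.continuous.continuousAt
    (show WithLp.toLp 2 (u, w) ∈ closure (G' : Set (WithLp 2 (H × H))) from h1)
  refine closure_mono ?_ h3
  rintro _ ⟨p, hp, rfl⟩
  exact hp

theorem inner_eq_of_mem_topologicalClosure {H : Type*} [NormedAddCommGroup H]
    [InnerProductSpace ℂ H] {G : Submodule ℂ (H × H)} {v z : H}
    (h : ∀ u w, (u, w) ∈ G → inner ℂ w v = inner ℂ u z) {u w : H}
    (huw : (u, w) ∈ G.topologicalClosure) : inner ℂ w v = inner ℂ u z := by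
  have hcl : IsClosed {p : H × H | inner ℂ p.2 v = inner ℂ p.1 z} :=
    isClosed_eq (by fun_prop) (by fun_prop)
  exact closure_minimal (fun p hp => h p.1 p.2 hp) hcl huw

/-- On an open set, `curl₀` and `curl` are adjoint to each other. -/
theorem isAdjointPair_curl {Ω : Set R3} (hΩ : IsOpen Ω) : IsAdjointPair (curl₀ Ω) (curl Ω) where
  mem_right_iff v z := by
    rw [graph_curl hΩ, graph_curl₀ hΩ, mem_weakCurlGraph_iff]
    exact ⟨fun h u w huw => inner_eq_of_mem_topologicalClosure h huw,
      fun h u w huw => h u w (Submodule.le_topologicalClosure _ huw)⟩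
  mem_left_iff u w := by
    rw [graph_curl hΩ, graph_curl₀ hΩ]
    refine ⟨fun huw v z hvz => ?_, fun h => mem_topologicalClosure_of_forall_adjoint fun v z hvz =>
      h v z (mem_weakCurlGraph_iff.2 hvz)⟩
    rw [← inner_conj_symm z u, ← inner_conj_symm v w,
      inner_eq_of_mem_topologicalClosure (mem_weakCurlGraph_iff.1 hvz) huw]

end Curl

/-! ### Multiplication operators -/

section Multiplication

variable {Ω : Set R3}

theorem mulOp_eq_toPMap {g : R3 → ℂ} {T : L2 Ω →L[ℂ] L2 Ω}
    (hT : ∀ u : L2 Ω, T u =ᵐ[volume.restrict Ω] fun x => g x • (u : R3 → C3) x) :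
    mulOp Ω g = T.toLinearMap.toPMap ⊤ := by
  refine LinearPMap.ext ?_ fun u hu _ => ?_
  · exact eq_top_iff.2 fun u _ => (memLp_congr_ae (hT u)).1 (Lp.memLp (T u))
  · refine Lp.ext ?_
    filter_upwards [(memLp_of_mem_mulDomain hu).coeFn_toLp, hT u] with x h1 h2
    exact h1.trans h2.symm

/-- Multiplication by a real bounded function `θ`, as a bounded operator in `L²(Ω)³`. -/
noncomputable def mulReal (θ : R3 → ℝ) (hθ : MemLp θ ⊤ (volume.restrict Ω)) : L2 Ω →L[ℂ] L2 Ω :=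
  (ContinuousLinearMap.lsmul ℂ ℂ : ℂ →L[ℂ] C3 →L[ℂ] C3).holderL (volume.restrict Ω) ⊤ 2 2
    (MemLp.toLp (fun x => (θ x : ℂ)) hθ.ofReal)

variable {θ : R3 → ℝ} (hθ : MemLp θ ⊤ (volume.restrict Ω))

theorem coeFn_mulReal (u : L2 Ω) :
    mulReal θ hθ u =ᵐ[volume.restrict Ω] fun x => (θ x : ℂ) • (u : R3 → C3) x := by
  filter_upwards [(ContinuousLinearMap.lsmul ℂ ℂ : ℂ →L[ℂ] C3 →L[ℂ] C3).coeFn_holder (r := 2)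
    (MemLp.toLp (fun x => (θ x : ℂ)) hθ.ofReal) u,
    (hθ.ofReal (K := ℂ)).coeFn_toLp] with x h1 h2
  exact h1.trans (congrArg (fun c : ℂ => c • (u : R3 → C3) x) h2)

theorem norm_mulReal_le (u : L2 Ω) : ‖mulReal θ hθ u‖ ≤ supNorm Ω θ * ‖u‖ := by
  have h1 : ‖MemLp.toLp (fun x => (θ x : ℂ)) hθ.ofReal‖ = supNorm Ω θ := by
    rw [Lp.norm_toLp, supNorm]
    congr 1
    exact eLpNorm_congr_norm_ae (Filter.Eventually.of_forall fun x => by simp)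
  refine ((ContinuousLinearMap.lsmul ℂ ℂ : ℂ →L[ℂ] C3 →L[ℂ] C3).norm_holder_apply_apply_le
    (r := 2) (MemLp.toLp (fun x => (θ x : ℂ)) hθ.ofReal) u).trans ?_
  rw [h1]
  have h2 : ‖(ContinuousLinearMap.lsmul ℂ ℂ : ℂ →L[ℂ] C3 →L[ℂ] C3)‖ ≤ 1 :=
    ContinuousLinearMap.opNorm_lsmul_le
  have h3 : 0 ≤ supNorm Ω θ := ENNReal.toReal_nonneg
  have : supNorm Ω θ * ‖u‖ = 1 * supNorm Ω θ * ‖u‖ := by ring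
  rw [this]
  gcongr

theorem le_norm_mulReal {c : ℝ} (hc : 0 ≤ c) (h : ∀ᵐ x ∂(volume.restrict Ω), c ≤ |θ x|) (u : L2 Ω) :
    c * ‖u‖ ≤ ‖mulReal θ hθ u‖ := by
  have h1 : ‖((c : ℂ) • u : L2 Ω)‖ = c * ‖u‖ := by
    rw [norm_smul, Complex.norm_real, Real.norm_of_nonneg hc]
  rw [← h1]
  refine Lp.norm_le_norm_of_ae_le ?_
  filter_upwards [h, coeFn_mulReal hθ u, Lp.coeFn_smul (c : ℂ) u] with x h1 h2 h3
  rw [h2, h3, Pi.smul_apply, norm_smul, norm_smul, Complex.norm_real, Complex.norm_real,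
    Real.norm_of_nonneg hc]
  gcongr
  exact h1

/-- Multiplication by `θ²`. -/
noncomputable def mulSq (θ : R3 → ℝ) (hθ : MemLp θ ⊤ (volume.restrict Ω)) : L2 Ω →L[ℂ] L2 Ω :=
  (mulReal θ hθ).comp (mulReal θ hθ)

theorem coeFn_mulSq (u : L2 Ω) :
    mulSq θ hθ u =ᵐ[volume.restrict Ω] fun x => (θ x : ℂ) ^ 2 • (u : R3 → C3) x := by
  filter_upwards [coeFn_mulReal hθ u, coeFn_mulReal hθ (mulReal θ hθ u)] with x h1 h2
  rw [sq, mul_smul, ← h1]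
  exact h2

theorem inner_mulSq (u : L2 Ω) : inner ℂ u (mulSq θ hθ u) = ((‖mulReal θ hθ u‖ ^ 2 : ℝ) : ℂ) := by
  have h1 : ∀ v w : L2 Ω, inner ℂ v (mulReal θ hθ w) = inner ℂ (mulReal θ hθ v) w := by
    intro v w
    rw [L2.inner_def, L2.inner_def]
    refine integral_congr_ae ?_
    filter_upwards [coeFn_mulReal hθ v, coeFn_mulReal hθ w] with x h1 h2
    rw [h1, h2, inner_smul_left, inner_smul_right, Complex.conj_ofReal]
  change inner ℂ u (mulReal θ hθ (mulReal θ hθ u)) = _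
  rw [h1, inner_self_eq_norm_sq_to_K, Complex.ofReal_pow]
  rfl

end Multiplication

/-! ### The pencils of the Drude-Lorentz system -/

section Pencils

theorem inner_self_eq_ofReal {H : Type*} [NormedAddCommGroup H] [InnerProductSpace ℂ H] (u : H) :
    inner ℂ u u = ((‖u‖ ^ 2 : ℝ) : ℂ) := by
  rw [inner_self_eq_norm_sq_to_K, Complex.ofReal_pow]
  rfl

theorem exists_inverse_of_im_inner {H : Type*} [NormedAddCommGroup H] [InnerProductSpace ℂ H]
    [CompleteSpace H] {T : H →L[ℂ] H} {D : ℝ} (hD : D ≠ 0)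
    (hT : ∀ z, (inner ℂ z (T z)).im = D * ‖z‖ ^ 2) : ∃ m, T * m = 1 ∧ m * T = 1 := by
  have hu : IsUnit T := by
    refine ContinuousLinearMap.isUnit_of_forall_le_norm_inner_map _ (c := ‖D‖₊)
      (nnnorm_pos.2 hD) fun z => ?_
    rw [← inner_conj_symm, RCLike.norm_conj]
    refine le_trans (le_of_eq ?_) (Complex.abs_im_le_norm _)
    rw [hT, abs_mul, abs_of_nonneg (sq_nonneg ‖z‖), mul_comm, coe_nnnorm, Real.norm_eq_abs]
  obtain ⟨U, hU⟩ := hu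
  exact ⟨U⁻¹.val, by rw [← hU, Units.mul_inv], by rw [← hU, Units.inv_mul]⟩

theorem neg_smul_one_add_inv_smul {H : Type*} [NormedAddCommGroup H] [InnerProductSpace ℂ H]
    (Q : H →L[ℂ] H) (ω : ℂ) {α : ℂ} (hα : α ≠ 0) :
    -ω • (1 : H →L[ℂ] H) + α⁻¹ • Q = -(α⁻¹ • ((α * ω) • (1 : H →L[ℂ] H) - Q)) := by
  rw [smul_sub, smul_smul, inv_mul_cancel_left₀ hα, neg_smul]
  abel

variable {Ω : Set R3} {θ : R3 → ℝ}

/-- `Θ(ω) = ω² + iγω - θ²` as a bounded operator. -/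
noncomputable def thetaOp (γ : ℝ) (θ : R3 → ℝ) (hθ : MemLp θ ⊤ (volume.restrict Ω)) (ω : ℂ) :
    L2 Ω →L[ℂ] L2 Ω :=
  (ω ^ 2 + Complex.I * γ * ω) • 1 - mulSq θ hθ

/-- The diagonal entry `-ω + θ² / (ω + iγ)` of the Drude-Lorentz pencil as a bounded operator. -/
noncomputable def diagOp (γ : ℝ) (θ : R3 → ℝ) (hθ : MemLp θ ⊤ (volume.restrict Ω)) (ω : ℂ) :
    L2 Ω →L[ℂ] L2 Ω :=
  -ω • 1 + (ω + Complex.I * γ)⁻¹ • mulSq θ hθ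

theorem coeFn_thetaOp (γ : ℝ) (hθ : MemLp θ ⊤ (volume.restrict Ω)) (ω : ℂ) (u : L2 Ω) :
    thetaOp γ θ hθ ω u =ᵐ[volume.restrict Ω] fun x => theta γ θ ω x • (u : R3 → C3) x := by
  filter_upwards [coeFn_mulSq hθ u, Lp.coeFn_smul (ω ^ 2 + Complex.I * γ * ω) u,
    Lp.coeFn_sub ((ω ^ 2 + Complex.I * γ * ω) • u) (mulSq θ hθ u)] with x h1 h2 h3
  refine h3.trans ?_
  rw [Pi.sub_apply, h1, h2, Pi.smul_apply, theta, sub_smul]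

theorem coeFn_diagOp (γ : ℝ) (hθ : MemLp θ ⊤ (volume.restrict Ω)) (ω : ℂ) (u : L2 Ω) :
    diagOp γ θ hθ ω u =ᵐ[volume.restrict Ω]
      fun x => (-ω + (θ x : ℂ) ^ 2 / (ω + Complex.I * γ)) • (u : R3 → C3) x := by
  filter_upwards [coeFn_mulSq hθ u, Lp.coeFn_smul (-ω) u,
    Lp.coeFn_smul (ω + Complex.I * γ)⁻¹ (mulSq θ hθ u),
    Lp.coeFn_add (-ω • u) ((ω + Complex.I * γ)⁻¹ • mulSq θ hθ u)] with x h1 h2 h3 h4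
  refine h4.trans ?_
  rw [Pi.add_apply, h2, h3, Pi.smul_apply, Pi.smul_apply, h1, add_smul, smul_smul,
    div_eq_inv_mul]

theorem diagOp_eq {γ : ℝ} (hθ : MemLp θ ⊤ (volume.restrict Ω)) {ω : ℂ}
    (h : ω + Complex.I * γ ≠ 0) :
    diagOp γ θ hθ ω = -((ω + Complex.I * γ)⁻¹ • thetaOp γ θ hθ ω) := by
  have h1 : ω ^ 2 + Complex.I * γ * ω = (ω + Complex.I * γ) * ω := by ring
  rw [diagOp, thetaOp, h1]
  exact neg_smul_one_add_inv_smul _ ω h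

theorem maxwellPencil_op {γe γm : ℝ} {θe θm : R3 → ℝ} (hθe : MemLp θe ⊤ (volume.restrict Ω))
    (hθm : MemLp θm ⊤ (volume.restrict Ω)) (ω : ℂ) :
    (maxwellPencil Ω γe γm θe θm).op ω =
      maxwellOp (curl₀ Ω) (curl Ω) (diagOp γe θe hθe ω) (diagOp γm θm hθm ω) := by
  change blockOp _ _ _ _ = blockOp _ _ _ _
  rw [mulOp_eq_toPMap (coeFn_diagOp γe hθe ω), mulOp_eq_toPMap (coeFn_diagOp γm hθm ω)]

theorem inner_diagOp (γ : ℝ) (hθ : MemLp θ ⊤ (volume.restrict Ω)) (ω : ℂ) (u : L2 Ω) :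
    inner ℂ u (diagOp γ θ hθ ω u) =
      -ω * ((‖u‖ ^ 2 : ℝ) : ℂ) + (ω + Complex.I * γ)⁻¹ * ((‖mulReal θ hθ u‖ ^ 2 : ℝ) : ℂ) := by
  change inner ℂ u (-ω • u + (ω + Complex.I * γ)⁻¹ • mulSq θ hθ u) = _
  rw [inner_add_right, inner_smul_right, inner_smul_right, inner_mulSq, inner_self_eq_ofReal]

theorem inner_thetaOp (γ : ℝ) (hθ : MemLp θ ⊤ (volume.restrict Ω)) (ω : ℂ) (u : L2 Ω) :
    inner ℂ u (thetaOp γ θ hθ ω u) = (ω ^ 2 + Complex.I * γ * ω) * ((‖u‖ ^ 2 : ℝ) : ℂ) -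
      ((‖mulReal θ hθ u‖ ^ 2 : ℝ) : ℂ) := by
  change inner ℂ u ((ω ^ 2 + Complex.I * γ * ω) • u - mulSq θ hθ u) = _
  rw [inner_sub_right, inner_smul_right, inner_mulSq, inner_self_eq_ofReal]

theorem im_inner_thetaOp (γ : ℝ) (hθ : MemLp θ ⊤ (volume.restrict Ω)) (ω : ℂ) (u : L2 Ω) :
    (inner ℂ u (thetaOp γ θ hθ ω u)).im = ω.re * (2 * ω.im + γ) * ‖u‖ ^ 2 := by
  have h1 : (ω ^ 2 + Complex.I * γ * ω).im = ω.re * (2 * ω.im + γ) := by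
    simp [sq]
    ring
  rw [inner_thetaOp, Complex.sub_im, Complex.ofReal_im, Complex.im_mul_ofReal, sub_zero, h1]

theorem thetaPencil_op (γ : ℝ) (hθ : MemLp θ ⊤ (volume.restrict Ω)) (ω : ℂ) :
    (thetaPencil Ω γ θ).op ω = (thetaOp γ θ hθ ω).toLinearMap.toPMap ⊤ :=
  mulOp_eq_toPMap (coeFn_thetaOp γ hθ ω)

theorem sigmaSet_iff {γ : ℝ} {ω : ℂ} : ω ∈ sigmaSet γ ↔ ω.re * (2 * ω.im + γ) ≠ 0 := by
  have h1 : ω.re * (2 * ω.im + γ) = 2 * (ω.re * (ω + Complex.I * γ / 2).im) := by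
    have : (ω + Complex.I * γ / 2).im = ω.im + γ / 2 := by
      rw [Complex.add_im, mul_div_assoc, Complex.I_mul_im]
      simp
    rw [this]
    ring
  rw [h1, mul_ne_zero_iff_left two_ne_zero]
  rfl

/-- The numerical range of `Θ(ω)` lies on the horizontal line through
`i Re ω (2 Im ω + γ)`, so that of the pencil `Θ` avoids the set `Σ`, which is open. -/
theorem notMem_closure_numRange_thetaPencil (γ : ℝ) (hθ : MemLp θ ⊤ (volume.restrict Ω)) {ω : ℂ}
    (hω : ω ∈ sigmaSet γ) : ω ∉ closure (thetaPencil Ω γ θ).numRange := by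
  intro hcl
  rw [sigmaSet_iff] at hω
  have hclosed : IsClosed {ω : ℂ | ω.re * (2 * ω.im + γ) = 0} :=
    isClosed_eq (by fun_prop) (by fun_prop)
  refine hω (closure_minimal (fun ζ hζ => ?_) hclosed hcl)
  have h1 : IsClosed {z : ℂ | z.im = ζ.re * (2 * ζ.im + γ)} :=
    isClosed_eq (by fun_prop) (by fun_prop)
  have h2 := hζ.2
  rw [thetaPencil_op γ hθ] at h2
  refine (closure_minimal (fun z hz => ?_) h1 h2 : (0 : ℂ).im = _).symm
  obtain ⟨u, hu, rfl⟩ := hz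
  refine (im_inner_thetaOp γ hθ ζ u).trans ?_
  rw [hu, one_pow, mul_one]

theorem add_I_mul_ne_zero_of_mem_dom {γe γm : ℝ} {θe θm : R3 → ℝ} {ω : ℂ}
    (h : ω ∈ (maxwellPencil Ω γe γm θe θm).dom) :
    ω + Complex.I * γe ≠ 0 ∧ ω + Complex.I * γm ≠ 0 :=
  ⟨fun h0 => h (Or.inl (eq_neg_of_add_eq_zero_left h0)),
    fun h0 => h (Or.inr (eq_neg_of_add_eq_zero_left h0))⟩

/-- At a point of the spectrum there are `U`, `V`, `E`, `F` that behave like `‖u‖²`, `‖v‖²`,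
`‖θₑ u‖²`, `‖θₘ v‖²` for an approximate null vector `(u, v)` of norm one. -/
theorem exists_quadratic_eq_of_mem_spectrum (hΩ : IsOpen Ω) {γe γm : ℝ} {θe θm : R3 → ℝ}
    (hθe : MemLp θe ⊤ (volume.restrict Ω)) (hθm : MemLp θm ⊤ (volume.restrict Ω)) {Le Lm : ℝ}
    (hLe : ∀ u, Le * ‖u‖ ^ 2 ≤ ‖mulReal θe hθe u‖ ^ 2)
    (hLm : ∀ v, Lm * ‖v‖ ^ 2 ≤ ‖mulReal θm hθm v‖ ^ 2)
    {ω : ℂ} (hω : ω ∈ (maxwellPencil Ω γe γm θe θm).spectrum) :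
    ∃ U V E F : ℝ, 0 ≤ U ∧ 0 ≤ V ∧ U + V = 1 ∧ 0 ≤ E ∧ Le * U ≤ E ∧ E ≤ supNorm Ω θe ^ 2 * U ∧
      0 ≤ F ∧ Lm * V ≤ F ∧ F ≤ supNorm Ω θm ^ 2 * V ∧
      -ω * U + E / (ω + Complex.I * γe) -
        (starRingEnd ℂ) (-ω * V + F / (ω + Complex.I * γm)) = 0 := by
  by_contra hcon
  refine hω.2 ?_
  rw [maxwellPencil_op hθe hθm]
  have hG : ∀ U V E F : ℝ, -ω * U + (starRingEnd ℂ) ω * V + (ω + Complex.I * γe)⁻¹ * E +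
      -(starRingEnd ℂ) (ω + Complex.I * γm)⁻¹ * F = -ω * U + E / (ω + Complex.I * γe) -
        (starRingEnd ℂ) (-ω * V + F / (ω + Complex.I * γm)) := by
    intro U V E F
    simp only [map_add, map_mul, map_neg, map_div₀, map_inv₀, Complex.conj_ofReal]
    ring
  obtain ⟨δ, hδ, hbd⟩ := exists_lower_bound_on_cone (-ω) ((starRingEnd ℂ) ω)
    (ω + Complex.I * γe)⁻¹ (-(starRingEnd ℂ) (ω + Complex.I * γm)⁻¹) (Le := Le) (Lm := Lm)
    (Te := supNorm Ω θe ^ 2) (Tm := supNorm Ω θm ^ 2)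
    fun U V E F h1 h2 h3 h4 h5 h6 h7 h8 h9 h0 =>
      hcon ⟨U, V, E, F, h1, h2, h3, h4, h5, h6, h7, h8, h9, (hG U V E F).symm.trans h0⟩
  have hsup : ∀ {θ : R3 → ℝ} (hθ : MemLp θ ⊤ (volume.restrict Ω)) (u : L2 Ω),
      ‖mulReal θ hθ u‖ ^ 2 ≤ supNorm Ω θ ^ 2 * ‖u‖ ^ 2 := fun hθ u => by
    rw [← mul_pow]
    exact pow_le_pow_left₀ (norm_nonneg _) (norm_mulReal_le hθ u) 2
  refine isRegularPoint_of_quadratic (isAdjointPair_curl hΩ) hδ fun u v => ?_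
  refine (hbd (‖u‖ ^ 2) (‖v‖ ^ 2) (‖mulReal θe hθe u‖ ^ 2) (‖mulReal θm hθm v‖ ^ 2) (by positivity)
    (by positivity) (by positivity) (hLe u) (hsup hθe u) (by positivity) (hLm v)
    (hsup hθm v)).trans_eq ?_
  rw [hG, inner_diagOp, inner_diagOp, div_eq_inv_mul, div_eq_inv_mul]

/-- The enclosure of the spectrum obtained from the quadratic form of the whole operator matrix. -/
theorem mem_gammaSet_union_zero_of_mem_spectrum (hΩ : IsOpen Ω) {γe γm : ℝ} (hγe : 0 < γe)
    (hγm : 0 < γm) {θe θm : R3 → ℝ} (hθe : MemLp θe ⊤ (volume.restrict Ω))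
    (hθm : MemLp θm ⊤ (volume.restrict Ω)) {ω : ℂ}
    (hω : ω ∈ (maxwellPencil Ω γe γm θe θm).spectrum) :
    ω ∈ gammaSet Ω γe γm θe θm ∪ {0} := by
  obtain ⟨U, V, E, F, hU, hV, hUV, hE, -, hET, hF, -, hFT, h0⟩ :=
    exists_quadratic_eq_of_mem_spectrum hΩ hθe hθm (Le := 0) (Lm := 0)
      (fun u => by rw [zero_mul]; positivity) (fun v => by rw [zero_mul]; positivity) hω
  obtain ⟨hωe, hωm⟩ := add_I_mul_ne_zero_of_mem_dom hω.1
  obtain ⟨h1, h2, -, h3⟩ := enclosure_of_quadratic_eq hγe hγm hωe hωm hU hV hUV hE hET hF hFT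
    (by positivity) (by positivity) h0
  by_cases hre : ω.re = 0
  · have hne : ∀ {γ : ℝ}, ω + Complex.I * γ ≠ 0 → ω.im ≠ -γ := fun h him =>
      h (Complex.ext (by simp [hre]) (by simp [him]))
    by_cases him : ω.im = 0
    · exact Or.inr (Complex.ext hre him)
    · refine Or.inl (Or.inl ⟨hre, ⟨?_, lt_of_le_of_ne (neg_nonneg.1 h1) him⟩, ?_⟩)
      · -- The lower end point `-M` of the interval is `-γₑ` or `-γₘ`.
        refine lt_of_le_of_ne (by linarith) fun h => ?_
        rcases max_choice γe γm with hM | hM <;> rw [hM] at h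
        · exact hne hωe h.symm
        · exact hne hωm h.symm
      · rintro (h | h)
        · exact hne hωe h
        · exact hne hωm h
  · exact Or.inl (Or.inr ⟨hre, (h3 hre).1, h1, le_min h2 (h3 hre).2⟩)

/-- If `|θₑ|` is bounded away from zero, a spectral point `0` would force `u = 0`; if moreover
`Θₘ(0) = -θₘ²` has a numerical range at positive distance from zero, also `v = 0`. -/
theorem zero_notMem_spectrum (hΩ : IsOpen Ω) {γe γm : ℝ} (hγe : 0 < γe) (hγm : 0 < γm)
    {θe θm : R3 → ℝ} (hθe : MemLp θe ⊤ (volume.restrict Ω))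
    (hθm : MemLp θm ⊤ (volume.restrict Ω)) {c : ℝ} (hc : 0 < c)
    (hce : ∀ᵐ x ∂(volume.restrict Ω), c ≤ |θe x|)
    (hW : (0 : ℂ) ∉ (thetaPencil Ω γm θm).numRange) :
    (0 : ℂ) ∉ (maxwellPencil Ω γe γm θe θm).spectrum := by
  intro h0
  have hW' : (0 : ℂ) ∉ closure (numRange ((thetaPencil Ω γm θm).op 0)) := fun h =>
    hW ⟨trivial, h⟩
  obtain ⟨δ, hδ, hbd⟩ := exists_lower_bound_of_zero_notMem_closure_numRange hW'
  have hLm : ∀ v, δ * ‖v‖ ^ 2 ≤ ‖mulReal θm hθm v‖ ^ 2 := fun v => by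
    have h1 := hbd v (thetaOp γm θm hθm 0 v) (by
      rw [thetaPencil_op γm hθm]
      exact LinearPMap.mem_graph ((thetaOp γm θm hθm 0).toLinearMap.toPMap ⊤) ⟨v, trivial⟩)
    rw [inner_thetaOp] at h1
    simpa using h1
  have hLe : ∀ u, c ^ 2 * ‖u‖ ^ 2 ≤ ‖mulReal θe hθe u‖ ^ 2 := fun u => by
    rw [← mul_pow]
    exact pow_le_pow_left₀ (by positivity) (le_norm_mulReal hθe hc.le hce u) 2
  obtain ⟨U, V, E, F, hU, hV, hUV, hE, hLE, hET, hF, hLF, hFT, heq⟩ :=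
    exists_quadratic_eq_of_mem_spectrum hΩ hθe hθm hLe hLm h0
  obtain ⟨hωe, hωm⟩ := add_I_mul_ne_zero_of_mem_dom h0.1
  obtain ⟨-, -, h3, -⟩ := enclosure_of_quadratic_eq hγe hγm hωe hωm hU hV hUV hE hET hF hFT
    (by positivity) (by positivity) heq
  obtain ⟨rfl, rfl⟩ := h3 rfl
  have hU0 : U ≤ 0 := nonpos_of_mul_nonpos_right hLE (by positivity)
  have hV0 : V ≤ 0 := nonpos_of_mul_nonpos_right hLF hδ
  linarith

/-- The spectrum in `Σ` is contained in the numerical range of the Schur complement. -/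
theorem mem_numRange_schurPencil_of_mem_spectrum (hΩ : IsOpen Ω) {γe γm : ℝ} {θe θm : R3 → ℝ}
    (hθe : MemLp θe ⊤ (volume.restrict Ω)) (hθm : MemLp θm ⊤ (volume.restrict Ω)) {ω : ℂ}
    (hω : ω ∈ (maxwellPencil Ω γe γm θe θm).spectrum) (hσ : ω ∈ sigmaSet γm) :
    ω ∈ (schurPencil Ω γe γm θe θm).numRange := by
  obtain ⟨hωe, hωm⟩ := add_I_mul_ne_zero_of_mem_dom hω.1
  have hD := sigmaSet_iff.1 hσ
  refine ⟨?_, ?_⟩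
  · rintro (h | h)
    · exact hω.1 h
    · exact notMem_closure_numRange_thetaPencil γm hθm hσ h
  by_contra h0
  refine hω.2 ?_
  rw [maxwellPencil_op hθe hθm, diagOp_eq hθm hωm]
  set D := ω.re * (2 * ω.im + γm) with hDdef
  have hΘ : ∀ z, (inner ℂ z (thetaOp γm θm hθm ω z)).im = D * ‖z‖ ^ 2 :=
    im_inner_thetaOp γm hθm ω
  obtain ⟨m, hΘm, hmΘ⟩ := exists_inverse_of_im_inner hD hΘ
  have hm : ∀ u : L2 Ω, m u =ᵐ[volume.restrict Ω]
      fun x => (theta γm θm ω x)⁻¹ • (u : R3 → C3) x := fun u => by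
    have h1 : thetaOp γm θm hθm ω (m u) = u := DFunLike.congr_fun hΘm u
    have h2 := coeFn_thetaOp γm hθm ω (m u)
    rw [h1] at h2
    filter_upwards [h2] with x hx
    have hne : theta γm θm ω x ≠ 0 := fun h => hD (by
      have := congrArg Complex.im h
      rw [theta, ← Complex.ofReal_pow, Complex.sub_im, Complex.ofReal_im] at this
      simp only [sq, Complex.add_im, Complex.mul_im, Complex.mul_re, Complex.I_re, Complex.I_im,
        Complex.ofReal_re, Complex.ofReal_im, Complex.zero_im] at this
      rw [hDdef]
      linear_combination this)
    rw [hx, inv_smul_smul₀ hne]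
  have hq : ∀ u : L2 Ω, (-((ω + Complex.I * γm)⁻¹ • diagOp γe θe hθe ω)) u =ᵐ[volume.restrict Ω]
      fun x => (theta γe θe ω x / ((ω + Complex.I * γe) * (ω + Complex.I * γm))) •
        (u : R3 → C3) x := fun u => by
    rw [diagOp_eq hθe hωe, smul_neg, neg_neg, smul_smul]
    filter_upwards [coeFn_thetaOp γe hθe ω u,
      Lp.coeFn_smul ((ω + Complex.I * γm)⁻¹ * (ω + Complex.I * γe)⁻¹)
        (thetaOp γe θe hθe ω u)] with x h1 h2
    refine h2.trans ?_
    rw [Pi.smul_apply, h1, smul_smul, ← mul_inv, mul_comm (ω + Complex.I * γm), div_eq_inv_mul]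
  refine isRegularPoint_of_zero_notMem_closure_numRange_schur (isAdjointPair_curl hΩ) hωm hD hΘ
    hmΘ hΘm ?_
  rw [← mulOp_eq_toPMap hm, ← mulOp_eq_toPMap hq]
  exact h0

end Pencils

end DrudeLorentz

theorem mainTheorem4 (Ω : Set DrudeLorentz.R3) (hΩ : IsOpen Ω)
    (γe γm : ℝ) (hγe : 0 < γe) (hγm : 0 < γm)
    (θe θm : DrudeLorentz.R3 → ℝ)
    (hθe : MemLp θe ⊤ (volume.restrict Ω)) (hθm : MemLp θm ⊤ (volume.restrict Ω)) :
    ((DrudeLorentz.maxwellPencil Ω γe γm θe θm).spectrum ∩ DrudeLorentz.sigmaSet γm ⊆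
      (DrudeLorentz.schurPencil Ω γe γm θe θm).numRange ∩ DrudeLorentz.sigmaSet γm) ∧
    ((DrudeLorentz.maxwellPencil Ω γe γm θe θm).spectrum \
        closure (DrudeLorentz.thetaPencil Ω γm θm).numRange ⊆
      (DrudeLorentz.gammaSet Ω γe γm θe θm ∪ {0}) \
        closure (DrudeLorentz.thetaPencil Ω γm θm).numRange) ∧
    ((∃ c : ℝ, 0 < c ∧ ∀ᵐ x ∂(volume.restrict Ω), c ≤ |θe x|) →
      (DrudeLorentz.maxwellPencil Ω γe γm θe θm).spectrum \
          closure (DrudeLorentz.thetaPencil Ω γm θm).numRange ⊆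
        DrudeLorentz.gammaSet Ω γe γm θe θm \
          closure (DrudeLorentz.thetaPencil Ω γm θm).numRange) := by
  open DrudeLorentz in
  exact ⟨fun ω hω => ⟨mem_numRange_schurPencil_of_mem_spectrum hΩ hθe hθm hω.1 hω.2, hω.2⟩,
    fun ω hω => ⟨mem_gammaSet_union_zero_of_mem_spectrum hΩ hγe hγm hθe hθm hω.1, hω.2⟩,
    fun ⟨c, hc, hce⟩ ω hω => by
      refine ⟨(mem_gammaSet_union_zero_of_mem_spectrum hΩ hγe hγm hθe hθm hω.1).resolve_right ?_,
        hω.2⟩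
      rintro rfl
      exact zero_notMem_spectrum hΩ hγe hγm hθe hθm hc hce (fun h => hω.2 (subset_closure h)) hω.1⟩
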